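/- **The calculus.** Fix a set of labels $\ell$. Kinds are $\kappa ::= \star_i \mid \mathsf L \mid \mathsf R\,\kappa \mid \kappa\to\kappa$ ($i\in\mathbb N$), with $\mathrm{level}(\star_i)=i$, $\mathrm{level}(\mathsf L)=0$, $\mathrm{level}(\mathsf R\,\kappa)=\mathrm{level}(\kappa)$, $\mathrm{level}(\kappa_1\to\kappa_2)=\max(\mathrm{level}\,\kappa_1,\mathrm{level}\,\kappa_2)$. Over a kinding environment $\Delta$ (a list of kinds for the type variables) the intrinsically kinded types are: variables; the inclusion of $\tau:\star_i$ in $\star_j$ for $i\le j$; $(\to):\star_i\to\star_i\to\star_i$; $\pi\Rightarrow\tau:\star_k$ for $\tau:\star_k$ and a predicate $\pi$ on rows of kind $\mathsf R\,\kappa$ with $\mathrm{level}(\kappa)<k$; $\forall\alpha{:}\kappa.\tau:\star_k$ for $\tau:\star_k$ and $\mathrm{level}(\kappa)<k$; $\lambda$-abstraction and application; labels $\ell:\mathsf L$; singleton types $\lfloor\xi\rfloor:\star_0$ for $\xi:\mathsf L$; labeled types $\xi\triangleright\tau:\kappa$ and singleton rows $\langle\xi\triangleright\tau\rangle:\mathsf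 R\,\kappa$ for $\xi:\mathsf L$, $\tau:\kappa$; $\Pi\rho,\Sigma\rho:\kappa$ for $\rho:\mathsf R\,\kappa$; and the lifted applications $\rho\,\tau:\mathsf R\,\kappa_2$ ($\rho:\mathsf R(\kappa_1\to\kappa_2)$, $\tau:\kappa_1$) and $\phi\,\rho:\mathsf R\,\kappa_2$ ($\phi:\kappa_1\to\kappa_2$, $\rho:\mathsf R\,\kappa_1$). Predicates are the directed containments $\rho_1\lesssim_d\rho_2$ ($d\in\{\mathrm{left},\mathrm{right}\}$) and the combination $\rho_1\odot\rho_2\sim\rho_3$, for rows of one kind $\mathsf R\,\kappa$. Equivalence $\equiv$ of types of the same kind is the congruence generated by $\beta$, $\langle\xi\triangleright\phi\rangle\,\tau\equiv\langle\xi\triangleright\phi\,\tau\rangle$, $\phi\,\langle\xi\triangleright\tau\rangle\equiv\langle\xi\triangleright\phi\,\tau\rangle$, $(K\rho)\,\tau\equiv K(\rho\,\tau)$ for $K\in\{\Pi,\Sigma\}$, and rules by which level inclusions are reflexive, transitive and commute with $\to$, $\Rightarrow$, $\forall$, $\triangleright$, $\Pi$, $\Sigma$; predicates are equivalent when their rows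 are. Given a predicate environment $\Phi$ (a list of predicates), entailment $\Phi\Vdash\pi$ of the minimal row theory is generated by: $\pi\in\Phi$; reflexivity and transitivity of $\lesssim_d$; closure under predicate equivalence; closure of $\lesssim_d$ and of $\odot$ under both lifted applications; and $\rho_1\lesssim_{\mathrm{left}}\rho_3$, $\rho_2\lesssim_{\mathrm{right}}\rho_3$ from $\rho_1\odot\rho_2\sim\rho_3$. Given also a typing environment $\Gamma$ (a list of types of base kinds), the intrinsically typed terms are: variables, $\lambda x.M$, $M\,N$; conversion along $\equiv$ and along level inclusions (both ways); introduction and elimination of $\pi\Rightarrow\tau$ (the latter by a derivation $\Phi\Vdash\pi$) and of $\forall$; $\ell:\lfloor\ell\rfloor$; labeling (from $\lfloor\xi\rfloor$ and $\tau$ to $\xi\triangleright\tau$) and unlabeling (from $\xi\triangleright\tau$ and $\lfloor\xi\rfloor$ to $\tau$); projection $\Pi\rho_1$ to $\Pi\rho_2$ given $\rho_2\lesssim_d\rho_1$; concatenation of $\Pi\rho_1$ and $\Pi\rho_2$ to $\Pi\rho_3$, and branching from $\Sigma\rho_1\to\tau$ and $\Sigma\rho_2\to\tau$ to $\Sigma\rho_3\to\tau$,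 given $\rho_1\odot\rho_2\sim\rho_3$; injection $\Sigma\rho_1$ to $\Sigma\rho_2$ given $\rho_1\lesssim_d\rho_2$; construction and deconstruction of singleton records and variants, between $\xi\triangleright\tau$ and $\Pi\langle\xi\triangleright\tau\rangle$, $\Sigma\langle\xi\triangleright\tau\rangle$; and the label-generic operators. To state these, write $$G_{l,u}[\theta]\;=\;\forall l{:}\mathsf L,\,u{:}\kappa,\,y_1,z,y_2{:}\mathsf R\,\kappa.\ (y_1\odot\langle l\triangleright u\rangle\sim z,\ z\odot y_2\sim\rho)\Rightarrow\lfloor l\rfloor\to\theta .$$ For $\rho:\mathsf R\,\kappa$ and $\phi:\kappa\to\star_i$: if $M:G_{l,u}[\phi\,u\to\tau]$ then $\mathsf{ana}_\phi M:\Sigma(\phi\,\rho)\to\tau$; if $M:G_{l,u}[\phi\,u]$ then $\mathsf{syn}_\phi M:\Pi(\phi\,\rho)$. For $\rho:\mathsf R\,\star_i$: if $M_1:G_{l,u}[u\to\upsilon]$, $M_2:\upsilon\to\upsilon\to\upsilon$, $M_3:\upsilon$ and $N:\Pi\rho$, then $\mathsf{fold}\,M_1\,M_2\,M_3\,N:\upsilon$.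 **The interpretation.** $\llbracket\star_n\rrbracket=U_n$, where $U_0,U_1,\dots$ is a tower of universes of types with inclusions $U_i\to U_j$ for $i\le j$: given an ambient universe of types, the codes of $U_n$ are generated by all types of the ambient universe, the unit type, functions, dependent functions and dependent pairs over $\mathrm{Fin}\,k$, functions from a type of evidence, and dependent functions over $\llbracket\kappa\rrbracket$ for kinds $\kappa$ of level less than $n$. Labels are read as the unit type; $\llbracket\mathsf R\,\kappa\rrbracket=\sum_{n\in\mathbb N}(\mathrm{Fin}\,n\to\llbracket\kappa\rrbracket)$; arrows of kinds are functions. Kinding environments are tuples, and each type $\tau:\kappa$ over $\Delta$ has an interpretation $\llbracket\tau\rrbracket H\in\llbracket\kappa\rrbracket$ for $H\in\llbracket\Delta\rrbracket$: $\lfloor\xi\rfloor$ is the unit type, $\xi\triangleright\tau$ is read as $\tau$, $\langle\xi\triangleright\tau\rangle$ as the one-entry family, lifted applications entrywise, $\forall$ as a dependent function type, $\pi\Rightarrow\tau$ as functions from evidence, and, at base kinds, $\Pi(n,P)=(i:\mathrm{Fin}\,n)\to P_i$ and $\Sigma(n,P)=\sum_{i:\mathrm{Fin}\,n}P_i$ (at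 other kinds $\Pi$ and $\Sigma$ are taken pointwise). Evidence for $(n,P)\lesssim(m,Q)$ gives for each $i:\mathrm{Fin}\,n$ some $j:\mathrm{Fin}\,m$ with $P_i=Q_j$; evidence for $(l,P)\odot(m,Q)\sim(n,R)$ gives for each $i:\mathrm{Fin}\,n$ either $j:\mathrm{Fin}\,l$ with $P_j=R_i$ or $j:\mathrm{Fin}\,m$ with $Q_j=R_i$, together with evidence for $(l,P)\lesssim(n,R)$ and $(m,Q)\lesssim(n,R)$. Predicate and typing environments are tuples of evidence and of elements. **Theorem (soundness of the type system).** There are an assignment to every derivation of $\Phi\Vdash\pi$ and all $H\in\llbracket\Delta\rrbracket$, $e\in\llbracket\Phi\rrbracket H$ of an element of $\llbracket\pi\rrbracket H$, and an assignment to every intrinsically typed term $M$ of type $\tau$ in $\Delta;\Phi;\Gamma$ and all $H\in\llbracket\Delta\rrbracket$, $e\in\llbracket\Phi\rrbracket H$, $g\in\llbracket\Gamma\rrbracket H$ of an element $\llbracket M\rrbracket(H,e,g)$ of the type $\llbracket\tau\rrbracket H$, which are compositional: * the entailment rules are read as lookup, identity and composition of containments, relabeling of entries under lifting, and the two containments stored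 in a combination; variables, abstraction and application, introduction and elimination of $\Rightarrow$ and of $\forall$ are read as lookup, functions and application; conversions are identities, up to the equality of the interpreted types; * labels denote the unit value, and labeling and unlabeling do nothing; projection precomposes a record with the evidence, injection replaces the tag by its image under the evidence, concatenation and branching select the component that the evidence designates; singleton construction and deconstruction are the evident maps; * for a row $\rho=(n,P)$ and $i:\mathrm{Fin}\,n$ let $\rho\,\mathrm{pick}\,i$ be the singleton row of $P_i$ and $\rho\,\mathrm{delete}\,i$ the row of the other entries, and let $b_i$ be the denotation of a label-generic body at the unit value, $u=P_i$, $y_1$ the empty row, $z=\rho\,\mathrm{pick}\,i$, $y_2=\rho\,\mathrm{delete}\,i$, with the evidence that the empty row is a left unit and the evidence $\mathrm{recombine}$ for $\rho\,\mathrm{pick}\,i\odot\rho\,\mathrm{delete}\,i\sim\rho$. Then $\mathsf{ana}$ sends $(i,v)$ to $b_i(v)$, $\mathsf{syn}$ is the record $i\mapsto b_i$, and $\mathsf{fold}$ on a record $r$ is $f(b_0(r_0),f(b_1(r_1),\dots f(b_{n-1}(r_{n-1}),e)))$ with $f$, $e$ the denotations of $M_2$, $M_3$. -/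

import Mathlib

universe u

namespace ROmega

/-! # Kinds and the tower of universes -/

/-- Stratified kinds. -/
inductive Kind : Type
  | star : ℕ → Kind
  | lab : Kind
  | row : Kind → Kind
  | arr : Kind → Kind → Kind

/-- The least level `i` such that the kind is a kind of level `i` (labels live at every level,
`κ₁ → κ₂` at the join of the levels of `κ₁` and `κ₂`). -/
def Kind.level : Kind → ℕ
  | .star i => i
  | .lab => 0
  | .row κ => κ.level
  | .arr κ₁ κ₂ => max κ₁.level κ₂.level

/-- Rows over `A`: a length `n` together with a family indexed by `Fin n`. -/
abbrev Row (A : Type u) : Type u := (n : ℕ) × (Fin n → A)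

/-- The interpretation of kinds, given the interpretation of the base kinds. Labels are read as
the unit type, rows as `Fin`-indexed families, arrows as functions. -/
def Kind.interpWith (F : ℕ → Type u) : Kind → Type u
  | .star i => F i
  | .lab => PUnit
  | .row κ => Row (κ.interpWith F)
  | .arr κ₁ κ₂ => κ₁.interpWith F → κ₂.interpWith F

/-- Codes for the types of level `n`. They contain every `A : Type u`, and are closed
under the unit type, functions, dependent functions and dependent pairs over `Fin k`, functions
from a type of evidence, and dependent functions over (the interpretation `S` of) any kind of
level less than `n`. -/
inductive Code (n : ℕ) (S : {κ : Kind // κ.level < n} → Type (u + 1)) : Type (u + 1)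
  | base : Type u → Code n S
  | unit : Code n S
  | arr : Code n S → Code n S → Code n S
  | pi : (k : ℕ) → (Fin k → Code n S) → Code n S
  | sigma : (k : ℕ) → (Fin k → Code n S) → Code n S
  | imp : Type → Code n S → Code n S
  | all : (κ : {κ : Kind // κ.level < n}) → (S κ → Code n S) → Code n S

/-- The tower of universes by recursion on the level. -/
def Tower (n : ℕ) : Type (u + 1) :=
  Code.{u} n (fun κ => Kind.interpWith (fun j => if _h : j < n then Tower j else PUnit) κ.1)
termination_by n

/-- The universe of types of level `n`: the interpretation of the kind `★ n`. -/
def Univ (n : ℕ) : Type (u + 1) :=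
  Code.{u} n (fun κ => Kind.interpWith Tower.{u} κ.1)

theorem Kind.interpWith_congr (F G : ℕ → Type u) :
    ∀ κ : Kind, (∀ j, j ≤ κ.level → F j = G j) → κ.interpWith F = κ.interpWith G
  | .star i, h => h i le_rfl
  | .lab, _ => rfl
  | .row κ, h => by
      simp only [Kind.interpWith]
      rw [Kind.interpWith_congr F G κ h]
  | .arr κ₁ κ₂, h => by
      simp only [Kind.interpWith]
      rw [Kind.interpWith_congr F G κ₁ fun j hj => h j (le_max_of_le_left hj),
        Kind.interpWith_congr F G κ₂ fun j hj => h j (le_max_of_le_right hj)]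

theorem tower_eq_univ : Tower.{u} = Univ.{u} := by
  funext n
  rw [Tower, Univ]
  congr 1
  funext κ
  refine Kind.interpWith_congr _ _ κ.1 fun j hj => ?_
  simp [lt_of_le_of_lt hj κ.2]

/-- The interpretation of kinds. -/
abbrev Kind.Interp (κ : Kind) : Type (u + 1) := κ.interpWith Univ.{u}

theorem Kind.interp_eq (κ : Kind) : κ.interpWith Tower.{u} = κ.Interp := by
  rw [tower_eq_univ]

namespace Univ

/-- The type of elements of a type of level `n`. -/
def El {n : ℕ} : Univ.{u} n → Type (u + 1)
  | .base A => ULift.{u + 1} A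
  | .unit => PUnit
  | .arr a b => El a → El b
  | .pi k f => (i : Fin k) → El (f i)
  | .sigma k f => (i : Fin k) × El (f i)
  | .imp E a => E → El a
  | .all κ f => (X : κ.1.Interp) → El (f (cast κ.1.interp_eq.symm X))

/-- Cumulativity: the inclusion of level `i` in level `j`. -/
def up {i j : ℕ} (h : i ≤ j) : Univ.{u} i → Univ.{u} j
  | .base A => Code.base A
  | .unit => Code.unit
  | .arr a b => Code.arr (up h a) (up h b)
  | .pi k f => Code.pi k fun x => up h (f x)
  | .sigma k f => Code.sigma k fun x => up h (f x)
  | .imp E a => Code.imp E (up h a)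
  | .all κ f => Code.all ⟨κ.1, lt_of_lt_of_le κ.2 h⟩ fun X => up h (f X)

/-- Quantification over a kind of lower level. -/
def all {n : ℕ} (κ : Kind) (h : κ.level < n) (f : κ.Interp → Univ.{u} n) : Univ.{u} n :=
  Code.all ⟨κ, h⟩ fun X => f (cast κ.interp_eq X)

end Univ

/-! # Semantic rows, evidence, and the record and variant operators -/

namespace Row

variable {A B : Type u}

def map (f : A → B) (ρ : Row A) : Row B := ⟨ρ.1, fun i => f (ρ.2 i)⟩

def single (a : A) : Row A := ⟨1, fun _ => a⟩

def empty : Row A := ⟨0, fun i => i.elim0⟩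

/-- The singleton row of the entry of `ρ` at `i`. -/
def pick (ρ : Row A) (i : Fin ρ.1) : Row A := single (ρ.2 i)

/-- The row of all entries of `ρ` but the one at `i`. -/
def delete : (ρ : Row A) → Fin ρ.1 → Row A
  | ⟨0, _⟩, i => i.elim0
  | ⟨n + 1, P⟩, i => ⟨n, fun j => P (i.succAbove j)⟩

end Row

/-- Evidence for containment: a map of indices that respects the entries. -/
def Leq {A : Type u} (ρ₁ ρ₂ : Row A) : Type :=
  (i : Fin ρ₁.1) → {j : Fin ρ₂.1 // ρ₁.2 i = ρ₂.2 j}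

/-- Evidence for combination: a map from the indices of `ρ₃` to those of `ρ₁` or `ρ₂`, and the
two containments. -/
structure Plus {A : Type u} (ρ₁ ρ₂ ρ₃ : Row A) : Type where
  split : (i : Fin ρ₃.1) → {j : Fin ρ₁.1 // ρ₁.2 j = ρ₃.2 i} ⊕ {j : Fin ρ₂.1 // ρ₂.2 j = ρ₃.2 i}
  left : Leq ρ₁ ρ₃
  right : Leq ρ₂ ρ₃

/-- Predicates on rows over `A`, and their types of evidence. -/
inductive RowPred (A : Type u) : Type u
  | leq : Row A → Row A → RowPred A
  | plus : Row A → Row A → Row A → RowPred A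

def RowPred.Evidence {A : Type u} : RowPred A → Type
  | .leq ρ₁ ρ₂ => Leq ρ₁ ρ₂
  | .plus ρ₁ ρ₂ ρ₃ => Plus ρ₁ ρ₂ ρ₃

section Evidence

variable {A B : Type u}

def Leq.refl (ρ : Row A) : Leq ρ ρ := fun i => ⟨i, rfl⟩

def Leq.trans {ρ₁ ρ₂ ρ₃ : Row A} (e : Leq ρ₁ ρ₂) (e' : Leq ρ₂ ρ₃) : Leq ρ₁ ρ₃ :=
  fun i => ⟨(e' (e i).1).1, (e i).2.trans (e' (e i).1).2⟩

def Leq.map (f : A → B) {ρ₁ ρ₂ : Row A} (e : Leq ρ₁ ρ₂) : Leq (ρ₁.map f) (ρ₂.map f) :=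
  fun i => ⟨(e i).1, congrArg f (e i).2⟩

def Plus.map (f : A → B) {ρ₁ ρ₂ ρ₃ : Row A} (e : Plus ρ₁ ρ₂ ρ₃) :
    Plus (ρ₁.map f) (ρ₂.map f) (ρ₃.map f) where
  split i := (e.split i).map (fun j => ⟨j.1, congrArg f j.2⟩) (fun j => ⟨j.1, congrArg f j.2⟩)
  left := e.left.map f
  right := e.right.map f

def pickedIn (ρ : Row A) (i : Fin ρ.1) : Leq (ρ.pick i) ρ := fun _ => ⟨i, rfl⟩

def deletedIn : (ρ : Row A) → (i : Fin ρ.1) → Leq (ρ.delete i) ρ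
  | ⟨0, _⟩, i => i.elim0
  | ⟨_ + 1, _⟩, i => fun j => ⟨i.succAbove j, rfl⟩

/-- Each index of `ρ` is either the picked index `i` or one of the remaining indices. -/
def recombineSplit : (ρ : Row A) → (i k : Fin ρ.1) →
    {j : Fin (ρ.pick i).1 // (ρ.pick i).2 j = ρ.2 k} ⊕
      {j : Fin (ρ.delete i).1 // (ρ.delete i).2 j = ρ.2 k}
  | ⟨0, _⟩, i, _ => i.elim0
  | ⟨_ + 1, P⟩, i, k =>
    if h : k = i then .inl ⟨(0 : Fin 1), congrArg P h.symm⟩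
    else .inr ⟨(finSuccAboveEquiv i).symm ⟨k, h⟩, congrArg P
      (congrArg Subtype.val ((finSuccAboveEquiv i).apply_symm_apply ⟨k, h⟩))⟩

/-- The picked entry and the remainder of a row combine to the row. -/
def recombine (ρ : Row A) (i : Fin ρ.1) : Plus (ρ.pick i) (ρ.delete i) ρ where
  split := recombineSplit ρ i
  left := pickedIn ρ i
  right := deletedIn ρ i

/-- The empty row is a left unit for combination. -/
def emptyPlus (ρ : Row A) : Plus Row.empty ρ ρ where
  split i := .inr ⟨i, rfl⟩
  left i := i.elim0
  right := Leq.refl ρ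

end Evidence

/-! The operators are stated for an arbitrary family `F` of types over the entries of a row. -/

section Operators

universe v

variable {A : Type u} (F : A → Type v)

/-- Records over a row: dependent functions. -/
abbrev Rec (ρ : Row A) : Type v := (i : Fin ρ.1) → F (ρ.2 i)

/-- Variants over a row: dependent pairs. -/
abbrev Var (ρ : Row A) : Type v := (i : Fin ρ.1) × F (ρ.2 i)

variable {F}

def Rec.prj {ρ₁ ρ₂ : Row A} (e : Leq ρ₂ ρ₁) (r : Rec F ρ₁) : Rec F ρ₂ :=
  fun i => cast (congrArg F (e i).2.symm) (r (e i).1)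

def Var.inj {ρ₁ ρ₂ : Row A} (e : Leq ρ₁ ρ₂) (w : Var F ρ₁) : Var F ρ₂ :=
  ⟨(e w.1).1, cast (congrArg F (e w.1).2) w.2⟩

def Rec.cat {ρ₁ ρ₂ ρ₃ : Row A} (e : Plus ρ₁ ρ₂ ρ₃) (r₁ : Rec F ρ₁) (r₂ : Rec F ρ₂) : Rec F ρ₃ :=
  fun i => match e.split i with
    | .inl j => cast (congrArg F j.2) (r₁ j.1)
    | .inr j => cast (congrArg F j.2) (r₂ j.1)

def Var.branch {T : Type v} {ρ₁ ρ₂ ρ₃ : Row A} (e : Plus ρ₁ ρ₂ ρ₃) (f₁ : Var F ρ₁ → T)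
    (f₂ : Var F ρ₂ → T) : Var F ρ₃ → T :=
  fun w => match e.split w.1 with
    | .inl j => f₁ ⟨j.1, cast (congrArg F j.2.symm) w.2⟩
    | .inr j => f₂ ⟨j.1, cast (congrArg F j.2.symm) w.2⟩

/-- The semantic type of the bodies of the label-generic operators: given a (trivial) label `l`,
an entry `a` and rows `y₁`, `z`, `y₂`, with evidence that `y₁` and the singleton row of `a` combine
to `z` and that `z` and `y₂` combine to `ρ`, and given the (trivial) value of the singleton type
of `l`, produce an element of `G a`. -/
abbrev Generic (ρ : Row A) (G : A → Type v) : Type (max u v) :=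
  (_l : PUnit.{u + 1}) → (a : A) → (y₁ z y₂ : Row A) →
    Plus y₁ (Row.single a) z → Plus z y₂ ρ → PUnit.{v + 1} → G a

/-- A label-generic body at the entry with index `i`. -/
def Generic.at {ρ : Row A} {G : A → Type v} (f : Generic ρ G) (i : Fin ρ.1) : G (ρ.2 i) :=
  f PUnit.unit (ρ.2 i) Row.empty (ρ.pick i) (ρ.delete i) (emptyPlus _) (recombine ρ i) PUnit.unit

def Generic.ana {ρ : Row A} {T : Type v} (f : Generic ρ fun a => F a → T) : Var F ρ → T :=
  fun w => f.at w.1 w.2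

def Generic.syn {ρ : Row A} (f : Generic ρ F) : Rec F ρ :=
  fun i => f.at i

def Generic.fold {ρ : Row A} {T : Type v} (f : Generic ρ fun a => F a → T) (op : T → T → T)
    (e : T) (r : Rec F ρ) : T :=
  Fin.foldr ρ.1 (fun i acc => op (f.at i (r i)) acc) e

end Operators

/-- Record types at all kinds: at base kind a dependent function type, at
arrow kinds pointwise (and likewise at row kinds; it is trivial at the label kind). -/
def piOp : (κ : Kind) → Row κ.Interp → κ.Interp
  | .star _, ρ => Code.pi ρ.1 ρ.2
  | .lab, _ => PUnit.unit
  | .row κ, ρ => ρ.map (piOp κ)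
  | .arr _ κ₂, ρ => fun X => piOp κ₂ (ρ.map fun f => f X)

/-- Variant types at all kinds: as `piOp`, with dependent pairs at base kind. -/
def sigmaOp : (κ : Kind) → Row κ.Interp → κ.Interp
  | .star _, ρ => Code.sigma ρ.1 ρ.2
  | .lab, _ => PUnit.unit
  | .row κ, ρ => ρ.map (sigmaOp κ)
  | .arr _ κ₂, ρ => fun X => sigmaOp κ₂ (ρ.map fun f => f X)

/-! # Syntax of types -/

/-- Kinding environments. -/
abbrev KEnv : Type := List Kind

/-- Type variables: positions in a kinding environment. -/
inductive TVar : KEnv → Kind → Type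
  | zero {Δ : KEnv} {κ : Kind} : TVar (κ :: Δ) κ
  | succ {Δ : KEnv} {κ κ' : Kind} : TVar Δ κ → TVar (κ' :: Δ) κ

/-- Directions of containment. -/
inductive Dir : Type
  | left
  | right

mutual

/-- Intrinsically kinded types over the labels `Lbl`. -/
inductive Ty (Lbl : Type) : KEnv → Kind → Type
  | var {Δ : KEnv} {κ : Kind} : TVar Δ κ → Ty Lbl Δ κ
  | up {Δ : KEnv} {i j : ℕ} : i ≤ j → Ty Lbl Δ (.star i) → Ty Lbl Δ (.star j)
  | arr {Δ : KEnv} (i : ℕ) : Ty Lbl Δ (.arr (.star i) (.arr (.star i) (.star i)))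
  | imp {Δ : KEnv} {κ : Kind} {k : ℕ} : κ.level < k → Pred Lbl Δ κ → Ty Lbl Δ (.star k) →
      Ty Lbl Δ (.star k)
  | all {Δ : KEnv} {k : ℕ} (κ : Kind) : κ.level < k → Ty Lbl (κ :: Δ) (.star k) →
      Ty Lbl Δ (.star k)
  | lam {Δ : KEnv} {κ₂ : Kind} (κ₁ : Kind) : Ty Lbl (κ₁ :: Δ) κ₂ → Ty Lbl Δ (.arr κ₁ κ₂)
  | app {Δ : KEnv} {κ₁ κ₂ : Kind} : Ty Lbl Δ (.arr κ₁ κ₂) → Ty Lbl Δ κ₁ → Ty Lbl Δ κ₂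
  | lab {Δ : KEnv} : Lbl → Ty Lbl Δ .lab
  | sing {Δ : KEnv} : Ty Lbl Δ .lab → Ty Lbl Δ (.star 0)
  | lty {Δ : KEnv} {κ : Kind} : Ty Lbl Δ .lab → Ty Lbl Δ κ → Ty Lbl Δ κ
  | row {Δ : KEnv} {κ : Kind} : Ty Lbl Δ .lab → Ty Lbl Δ κ → Ty Lbl Δ (.row κ)
  | pi {Δ : KEnv} {κ : Kind} : Ty Lbl Δ (.row κ) → Ty Lbl Δ κ
  | sigma {Δ : KEnv} {κ : Kind} : Ty Lbl Δ (.row κ) → Ty Lbl Δ κ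
  | lift₁ {Δ : KEnv} {κ₁ κ₂ : Kind} : Ty Lbl Δ (.row (.arr κ₁ κ₂)) → Ty Lbl Δ κ₁ →
      Ty Lbl Δ (.row κ₂)
  | lift₂ {Δ : KEnv} {κ₁ κ₂ : Kind} : Ty Lbl Δ (.arr κ₁ κ₂) → Ty Lbl Δ (.row κ₁) →
      Ty Lbl Δ (.row κ₂)

/-- Intrinsically kinded predicates: `leq d ρ₁ ρ₂` is containment, `plus ρ₁ ρ₂ ρ₃` says that
`ρ₁` and `ρ₂` combine to `ρ₃`. -/
inductive Pred (Lbl : Type) : KEnv → Kind → Type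
  | leq {Δ : KEnv} {κ : Kind} : Dir → Ty Lbl Δ (.row κ) → Ty Lbl Δ (.row κ) → Pred Lbl Δ κ
  | plus {Δ : KEnv} {κ : Kind} : Ty Lbl Δ (.row κ) → Ty Lbl Δ (.row κ) → Ty Lbl Δ (.row κ) →
      Pred Lbl Δ κ

end

section TypeSyntax

variable {Lbl : Type}

/-- Renamings of type variables. -/
def Ren (Δ Δ' : KEnv) : Type := (κ : Kind) → TVar Δ κ → TVar Δ' κ

def Ren.lift {Δ Δ' : KEnv} (r : Ren Δ Δ') (κ' : Kind) : Ren (κ' :: Δ) (κ' :: Δ')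
  | _, .zero => .zero
  | _, .succ x => .succ (r _ x)

mutual

def Ty.rename {Δ Δ' : KEnv} {κ : Kind} (r : Ren Δ Δ') : Ty Lbl Δ κ → Ty Lbl Δ' κ
  | .var x => .var (r _ x)
  | .up h τ => .up h (τ.rename r)
  | .arr i => .arr i
  | .imp h π τ => .imp h (π.rename r) (τ.rename r)
  | .all κ h τ => .all κ h (τ.rename (r.lift κ))
  | .lam κ τ => .lam κ (τ.rename (r.lift κ))
  | .app φ τ => .app (φ.rename r) (τ.rename r)
  | .lab l => .lab l
  | .sing ξ => .sing (ξ.rename r)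
  | .lty ξ τ => .lty (ξ.rename r) (τ.rename r)
  | .row ξ τ => .row (ξ.rename r) (τ.rename r)
  | .pi ρ => .pi (ρ.rename r)
  | .sigma ρ => .sigma (ρ.rename r)
  | .lift₁ ρ τ => .lift₁ (ρ.rename r) (τ.rename r)
  | .lift₂ φ ρ => .lift₂ (φ.rename r) (ρ.rename r)

def Pred.rename {Δ Δ' : KEnv} {κ : Kind} (r : Ren Δ Δ') : Pred Lbl Δ κ → Pred Lbl Δ' κ
  | .leq d ρ₁ ρ₂ => .leq d (ρ₁.rename r) (ρ₂.rename r)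
  | .plus ρ₁ ρ₂ ρ₃ => .plus (ρ₁.rename r) (ρ₂.rename r) (ρ₃.rename r)

end

/-- Weakening by one type variable. -/
def Ty.wk {Δ : KEnv} {κ κ' : Kind} (τ : Ty Lbl Δ κ) : Ty Lbl (κ' :: Δ) κ :=
  τ.rename fun _ x => .succ x

def Pred.wk {Δ : KEnv} {κ κ' : Kind} (π : Pred Lbl Δ κ) : Pred Lbl (κ' :: Δ) κ :=
  π.rename fun _ x => .succ x

/-- Substitutions of types for type variables. -/
def Sub (Lbl : Type) (Δ Δ' : KEnv) : Type := (κ : Kind) → TVar Δ κ → Ty Lbl Δ' κ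

def Sub.lift {Δ Δ' : KEnv} (s : Sub Lbl Δ Δ') (κ' : Kind) : Sub Lbl (κ' :: Δ) (κ' :: Δ')
  | _, .zero => .var .zero
  | _, .succ x => (s _ x).wk

mutual

def Ty.subst {Δ Δ' : KEnv} {κ : Kind} (s : Sub Lbl Δ Δ') : Ty Lbl Δ κ → Ty Lbl Δ' κ
  | .var x => s _ x
  | .up h τ => .up h (τ.subst s)
  | .arr i => .arr i
  | .imp h π τ => .imp h (π.subst s) (τ.subst s)
  | .all κ h τ => .all κ h (τ.subst (s.lift κ))
  | .lam κ τ => .lam κ (τ.subst (s.lift κ))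
  | .app φ τ => .app (φ.subst s) (τ.subst s)
  | .lab l => .lab l
  | .sing ξ => .sing (ξ.subst s)
  | .lty ξ τ => .lty (ξ.subst s) (τ.subst s)
  | .row ξ τ => .row (ξ.subst s) (τ.subst s)
  | .pi ρ => .pi (ρ.subst s)
  | .sigma ρ => .sigma (ρ.subst s)
  | .lift₁ ρ τ => .lift₁ (ρ.subst s) (τ.subst s)
  | .lift₂ φ ρ => .lift₂ (φ.subst s) (ρ.subst s)

def Pred.subst {Δ Δ' : KEnv} {κ : Kind} (s : Sub Lbl Δ Δ') : Pred Lbl Δ κ → Pred Lbl Δ' κ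
  | .leq d ρ₁ ρ₂ => .leq d (ρ₁.subst s) (ρ₂.subst s)
  | .plus ρ₁ ρ₂ ρ₃ => .plus (ρ₁.subst s) (ρ₂.subst s) (ρ₃.subst s)

end

/-- The substitution of `υ` for the most recent type variable. -/
def Sub.single {Δ : KEnv} {κ' : Kind} (υ : Ty Lbl Δ κ') : Sub Lbl (κ' :: Δ) Δ
  | _, .zero => υ
  | _, .succ x => .var x

/-- `τ[υ/α]` for the most recent type variable `α`. -/
def Ty.inst {Δ : KEnv} {κ κ' : Kind} (τ : Ty Lbl (κ' :: Δ) κ) (υ : Ty Lbl Δ κ') : Ty Lbl Δ κ :=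
  τ.subst (Sub.single υ)

/-- Function types. -/
def Ty.fn {Δ : KEnv} {i : ℕ} (τ υ : Ty Lbl Δ (.star i)) : Ty Lbl Δ (.star i) :=
  .app (.app (.arr i) τ) υ

end TypeSyntax

/-! # Type and predicate equivalence -/

mutual

/-- Equivalence of types. The rules `up_*` say that the inclusions between levels, which leave no
trace in an unkinded type, commute with the type formers. -/
inductive TyEq {Lbl : Type} : {Δ : KEnv} → {κ : Kind} → Ty Lbl Δ κ → Ty Lbl Δ κ → Prop
  | refl {Δ : KEnv} {κ : Kind} (τ : Ty Lbl Δ κ) : TyEq τ τ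
  | symm {Δ : KEnv} {κ : Kind} {τ₁ τ₂ : Ty Lbl Δ κ} : TyEq τ₁ τ₂ → TyEq τ₂ τ₁
  | trans {Δ : KEnv} {κ : Kind} {τ₁ τ₂ τ₃ : Ty Lbl Δ κ} : TyEq τ₁ τ₂ → TyEq τ₂ τ₃ → TyEq τ₁ τ₃
  | beta {Δ : KEnv} {κ₁ κ₂ : Kind} (τ : Ty Lbl (κ₁ :: Δ) κ₂) (υ : Ty Lbl Δ κ₁) :
      TyEq (.app (.lam κ₁ τ) υ) (τ.inst υ)
  | imp {Δ : KEnv} {κ : Kind} {k : ℕ} (h : κ.level < k) {π₁ π₂ : Pred Lbl Δ κ}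
      {τ₁ τ₂ : Ty Lbl Δ (.star k)} : PredEq π₁ π₂ → TyEq τ₁ τ₂ →
      TyEq (.imp h π₁ τ₁) (.imp h π₂ τ₂)
  | all {Δ : KEnv} {κ : Kind} {k : ℕ} (h : κ.level < k) {τ₁ τ₂ : Ty Lbl (κ :: Δ) (.star k)} :
      TyEq τ₁ τ₂ → TyEq (.all κ h τ₁) (.all κ h τ₂)
  | lam {Δ : KEnv} {κ₁ κ₂ : Kind} {τ₁ τ₂ : Ty Lbl (κ₁ :: Δ) κ₂} :
      TyEq τ₁ τ₂ → TyEq (.lam κ₁ τ₁) (.lam κ₁ τ₂)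
  | app {Δ : KEnv} {κ₁ κ₂ : Kind} {φ₁ φ₂ : Ty Lbl Δ (.arr κ₁ κ₂)} {τ₁ τ₂ : Ty Lbl Δ κ₁} :
      TyEq φ₁ φ₂ → TyEq τ₁ τ₂ → TyEq (.app φ₁ τ₁) (.app φ₂ τ₂)
  | lift₁ {Δ : KEnv} {κ₁ κ₂ : Kind} {ρ₁ ρ₂ : Ty Lbl Δ (.row (.arr κ₁ κ₂))}
      {τ₁ τ₂ : Ty Lbl Δ κ₁} :
      TyEq ρ₁ ρ₂ → TyEq τ₁ τ₂ → TyEq (.lift₁ ρ₁ τ₁) (.lift₁ ρ₂ τ₂)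
  | lift₂ {Δ : KEnv} {κ₁ κ₂ : Kind} {φ₁ φ₂ : Ty Lbl Δ (.arr κ₁ κ₂)}
      {ρ₁ ρ₂ : Ty Lbl Δ (.row κ₁)} :
      TyEq φ₁ φ₂ → TyEq ρ₁ ρ₂ → TyEq (.lift₂ φ₁ ρ₁) (.lift₂ φ₂ ρ₂)
  | lty {Δ : KEnv} {κ : Kind} {ξ₁ ξ₂ : Ty Lbl Δ .lab} {τ₁ τ₂ : Ty Lbl Δ κ} :
      TyEq ξ₁ ξ₂ → TyEq τ₁ τ₂ → TyEq (.lty ξ₁ τ₁) (.lty ξ₂ τ₂)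
  | row {Δ : KEnv} {κ : Kind} {ξ₁ ξ₂ : Ty Lbl Δ .lab} {τ₁ τ₂ : Ty Lbl Δ κ} :
      TyEq ξ₁ ξ₂ → TyEq τ₁ τ₂ → TyEq (.row ξ₁ τ₁) (.row ξ₂ τ₂)
  | sing {Δ : KEnv} {ξ₁ ξ₂ : Ty Lbl Δ .lab} : TyEq ξ₁ ξ₂ → TyEq (.sing ξ₁) (.sing ξ₂)
  | pi {Δ : KEnv} {κ : Kind} {ρ₁ ρ₂ : Ty Lbl Δ (.row κ)} : TyEq ρ₁ ρ₂ → TyEq (.pi ρ₁) (.pi ρ₂)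
  | sigma {Δ : KEnv} {κ : Kind} {ρ₁ ρ₂ : Ty Lbl Δ (.row κ)} :
      TyEq ρ₁ ρ₂ → TyEq (.sigma ρ₁) (.sigma ρ₂)
  | lift₁_row {Δ : KEnv} {κ₁ κ₂ : Kind} (ξ : Ty Lbl Δ .lab) (φ : Ty Lbl Δ (.arr κ₁ κ₂))
      (τ : Ty Lbl Δ κ₁) : TyEq (.lift₁ (.row ξ φ) τ) (.row ξ (.app φ τ))
  | lift₂_row {Δ : KEnv} {κ₁ κ₂ : Kind} (ξ : Ty Lbl Δ .lab) (φ : Ty Lbl Δ (.arr κ₁ κ₂))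
      (τ : Ty Lbl Δ κ₁) : TyEq (.lift₂ φ (.row ξ τ)) (.row ξ (.app φ τ))
  | lift₃_pi {Δ : KEnv} {κ₁ κ₂ : Kind} (ρ : Ty Lbl Δ (.row (.arr κ₁ κ₂))) (τ : Ty Lbl Δ κ₁) :
      TyEq (.app (.pi ρ) τ) (.pi (.lift₁ ρ τ))
  | lift₃_sigma {Δ : KEnv} {κ₁ κ₂ : Kind} (ρ : Ty Lbl Δ (.row (.arr κ₁ κ₂))) (τ : Ty Lbl Δ κ₁) :
      TyEq (.app (.sigma ρ) τ) (.sigma (.lift₁ ρ τ))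
  | up {Δ : KEnv} {i j : ℕ} (h : i ≤ j) {τ₁ τ₂ : Ty Lbl Δ (.star i)} :
      TyEq τ₁ τ₂ → TyEq (.up h τ₁) (.up h τ₂)
  | up_refl {Δ : KEnv} {i : ℕ} (h : i ≤ i) (τ : Ty Lbl Δ (.star i)) : TyEq (.up h τ) τ
  | up_trans {Δ : KEnv} {i j k : ℕ} (h : i ≤ j) (h' : j ≤ k) (τ : Ty Lbl Δ (.star i)) :
      TyEq (.up h' (.up h τ)) (.up (h.trans h') τ)
  | up_arr {Δ : KEnv} {i j : ℕ} (h : i ≤ j) (τ υ : Ty Lbl Δ (.star i)) :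
      TyEq (.up h (τ.fn υ)) ((Ty.up h τ).fn (.up h υ))
  | up_imp {Δ : KEnv} {κ : Kind} {i j : ℕ} (h : i ≤ j) (h' : κ.level < i) (π : Pred Lbl Δ κ)
      (τ : Ty Lbl Δ (.star i)) :
      TyEq (.up h (.imp h' π τ)) (.imp (h'.trans_le h) π (.up h τ))
  | up_all {Δ : KEnv} {κ : Kind} {i j : ℕ} (h : i ≤ j) (h' : κ.level < i)
      (τ : Ty Lbl (κ :: Δ) (.star i)) :
      TyEq (.up h (.all κ h' τ)) (.all κ (h'.trans_le h) (.up h τ))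
  | up_lty {Δ : KEnv} {i j : ℕ} (h : i ≤ j) (ξ : Ty Lbl Δ .lab) (τ : Ty Lbl Δ (.star i)) :
      TyEq (.up h (.lty ξ τ)) (.lty ξ (.up h τ))
  | up_pi {Δ : KEnv} {i j : ℕ} (h : i ≤ j) (ρ : Ty Lbl Δ (.row (.star i))) :
      TyEq (.up h (.pi ρ)) (.pi (.lift₂ (.lam (.star i) (.up h (.var .zero))) ρ))
  | up_sigma {Δ : KEnv} {i j : ℕ} (h : i ≤ j) (ρ : Ty Lbl Δ (.row (.star i))) :
      TyEq (.up h (.sigma ρ)) (.sigma (.lift₂ (.lam (.star i) (.up h (.var .zero))) ρ))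

/-- Equivalence of predicates. -/
inductive PredEq {Lbl : Type} : {Δ : KEnv} → {κ : Kind} → Pred Lbl Δ κ → Pred Lbl Δ κ → Prop
  | leq {Δ : KEnv} {κ : Kind} (d : Dir) {ρ₁ ρ₂ ρ₁' ρ₂' : Ty Lbl Δ (.row κ)} :
      TyEq ρ₁ ρ₁' → TyEq ρ₂ ρ₂' → PredEq (.leq d ρ₁ ρ₂) (.leq d ρ₁' ρ₂')
  | plus {Δ : KEnv} {κ : Kind} {ρ₁ ρ₂ ρ₃ ρ₁' ρ₂' ρ₃' : Ty Lbl Δ (.row κ)} :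
      TyEq ρ₁ ρ₁' → TyEq ρ₂ ρ₂' → TyEq ρ₃ ρ₃' → PredEq (.plus ρ₁ ρ₂ ρ₃) (.plus ρ₁' ρ₂' ρ₃')

end

/-! # Predicate environments and entailment -/

/-- Predicate environments. -/
inductive PEnv (Lbl : Type) (Δ : KEnv) : Type
  | nil : PEnv Lbl Δ
  | cons {κ : Kind} : PEnv Lbl Δ → Pred Lbl Δ κ → PEnv Lbl Δ

/-- Positions of a predicate in a predicate environment. -/
inductive PVar {Lbl : Type} {Δ : KEnv} : {κ : Kind} → PEnv Lbl Δ → Pred Lbl Δ κ → Type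
  | zero {κ : Kind} {Φ : PEnv Lbl Δ} {π : Pred Lbl Δ κ} : PVar (Φ.cons π) π
  | succ {κ κ' : Kind} {Φ : PEnv Lbl Δ} {π : Pred Lbl Δ κ} {π' : Pred Lbl Δ κ'} :
      PVar Φ π → PVar (Φ.cons π') π

/-- Entailment of the minimal row theory. -/
inductive Ent {Lbl : Type} {Δ : KEnv} (Φ : PEnv Lbl Δ) : {κ : Kind} → Pred Lbl Δ κ → Type
  | ax {κ : Kind} {π : Pred Lbl Δ κ} : PVar Φ π → Ent Φ π
  | refl {κ : Kind} (d : Dir) (ρ : Ty Lbl Δ (.row κ)) : Ent Φ (.leq d ρ ρ)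
  | trans {κ : Kind} {d : Dir} {ρ₁ ρ₂ ρ₃ : Ty Lbl Δ (.row κ)} :
      Ent Φ (.leq d ρ₁ ρ₂) → Ent Φ (.leq d ρ₂ ρ₃) → Ent Φ (.leq d ρ₁ ρ₃)
  | conv {κ : Kind} {π₁ π₂ : Pred Lbl Δ κ} : Ent Φ π₁ → PredEq π₁ π₂ → Ent Φ π₂
  | leqLift₁ {κ₁ κ₂ : Kind} {d : Dir} {ρ₁ ρ₂ : Ty Lbl Δ (.row κ₁)} (φ : Ty Lbl Δ (.arr κ₁ κ₂)) :
      Ent Φ (.leq d ρ₁ ρ₂) → Ent Φ (.leq d (.lift₂ φ ρ₁) (.lift₂ φ ρ₂))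
  | leqLift₂ {κ₁ κ₂ : Kind} {d : Dir} {ρ₁ ρ₂ : Ty Lbl Δ (.row (.arr κ₁ κ₂))} (τ : Ty Lbl Δ κ₁) :
      Ent Φ (.leq d ρ₁ ρ₂) → Ent Φ (.leq d (.lift₁ ρ₁ τ) (.lift₁ ρ₂ τ))
  | plusLift₁ {κ₁ κ₂ : Kind} {ρ₁ ρ₂ ρ₃ : Ty Lbl Δ (.row (.arr κ₁ κ₂))} (τ : Ty Lbl Δ κ₁) :
      Ent Φ (.plus ρ₁ ρ₂ ρ₃) → Ent Φ (.plus (.lift₁ ρ₁ τ) (.lift₁ ρ₂ τ) (.lift₁ ρ₃ τ))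
  | plusLift₂ {κ₁ κ₂ : Kind} {ρ₁ ρ₂ ρ₃ : Ty Lbl Δ (.row κ₁)} (φ : Ty Lbl Δ (.arr κ₁ κ₂)) :
      Ent Φ (.plus ρ₁ ρ₂ ρ₃) → Ent Φ (.plus (.lift₂ φ ρ₁) (.lift₂ φ ρ₂) (.lift₂ φ ρ₃))
  | plusLeft {κ : Kind} {ρ₁ ρ₂ ρ₃ : Ty Lbl Δ (.row κ)} :
      Ent Φ (.plus ρ₁ ρ₂ ρ₃) → Ent Φ (.leq .left ρ₁ ρ₃)
  | plusRight {κ : Kind} {ρ₁ ρ₂ ρ₃ : Ty Lbl Δ (.row κ)} :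
      Ent Φ (.plus ρ₁ ρ₂ ρ₃) → Ent Φ (.leq .right ρ₂ ρ₃)

/-! # Terms -/

/-- Typing environments. -/
inductive Env (Lbl : Type) (Δ : KEnv) : Type
  | nil : Env Lbl Δ
  | cons {i : ℕ} : Env Lbl Δ → Ty Lbl Δ (.star i) → Env Lbl Δ

/-- Term variables: positions in a typing environment. -/
inductive EVar {Lbl : Type} {Δ : KEnv} : {i : ℕ} → Env Lbl Δ → Ty Lbl Δ (.star i) → Type
  | zero {i : ℕ} {Γ : Env Lbl Δ} {τ : Ty Lbl Δ (.star i)} : EVar (Γ.cons τ) τ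
  | succ {i j : ℕ} {Γ : Env Lbl Δ} {τ : Ty Lbl Δ (.star i)} {υ : Ty Lbl Δ (.star j)} :
      EVar Γ τ → EVar (Γ.cons υ) τ

section TermSyntax

variable {Lbl : Type} {Δ : KEnv}

def PEnv.wk {κ' : Kind} : PEnv Lbl Δ → PEnv Lbl (κ' :: Δ)
  | .nil => .nil
  | .cons Φ π => .cons Φ.wk π.wk

def Env.wk {κ' : Kind} : Env Lbl Δ → Env Lbl (κ' :: Δ)
  | .nil => .nil
  | .cons Γ τ => .cons Γ.wk τ.wk

/-- The environment `Δ, l : L, u : κ, y₁ : R κ, z : R κ, y₂ : R κ`. -/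
abbrev KEnv.generic (Δ : KEnv) (κ : Kind) : KEnv :=
  .row κ :: .row κ :: .row κ :: κ :: .lab :: Δ

/-- Weakening to `Δ, l, u, y₁, z, y₂`. -/
def Ty.wkGeneric {κ κ' : Kind} (τ : Ty Lbl Δ κ') : Ty Lbl (Δ.generic κ) κ' :=
  τ.wk.wk.wk.wk.wk

/-- The type variable `l` of the generic environment. -/
def Ty.genericL {κ : Kind} : Ty Lbl (Δ.generic κ) .lab := .var (.succ (.succ (.succ (.succ .zero))))

/-- The type variable `u` of the generic environment. -/
def Ty.genericU {κ : Kind} : Ty Lbl (Δ.generic κ) κ := .var (.succ (.succ (.succ .zero)))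

/-- The type `∀ l : L, u : κ, y₁ z y₂ : R κ. (y₁ ⊙ ⟨l ▷ u⟩ ~ z, z ⊙ y₂ ~ ρ) ⇒ ⌊l⌋ → τ`. -/
def Ty.generic {κ : Kind} {m : ℕ} (h : κ.level < m) (ρ : Ty Lbl Δ (.row κ))
    (τ : Ty Lbl (Δ.generic κ) (.star m)) : Ty Lbl Δ (.star m) :=
  .all .lab (lt_of_le_of_lt (Nat.zero_le _) h) <| .all κ h <|
    .all (.row κ) h <| .all (.row κ) h <| .all (.row κ) h <|
    .imp h (.plus (.var (.succ (.succ .zero))) (.row .genericL .genericU) (.var (.succ .zero))) <|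
    .imp h (.plus (.var (.succ .zero)) (.var .zero) ρ.wkGeneric) <|
    (Ty.up (Nat.zero_le m) (.sing .genericL)).fn τ

end TermSyntax

/-- Intrinsically typed terms. -/
inductive Tm {Lbl : Type} : {Δ : KEnv} → PEnv Lbl Δ → Env Lbl Δ → {i : ℕ} →
    Ty Lbl Δ (.star i) → Type
  | var {Δ : KEnv} {Φ : PEnv Lbl Δ} {Γ : Env Lbl Δ} {i : ℕ} {τ : Ty Lbl Δ (.star i)} :
      EVar Γ τ → Tm Φ Γ τ
  | lam {Δ : KEnv} {Φ : PEnv Lbl Δ} {Γ : Env Lbl Δ} {i : ℕ} {τ υ : Ty Lbl Δ (.star i)} :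
      Tm Φ (Γ.cons τ) υ → Tm Φ Γ (τ.fn υ)
  | app {Δ : KEnv} {Φ : PEnv Lbl Δ} {Γ : Env Lbl Δ} {i : ℕ} {τ υ : Ty Lbl Δ (.star i)} :
      Tm Φ Γ (τ.fn υ) → Tm Φ Γ τ → Tm Φ Γ υ
  | conv {Δ : KEnv} {Φ : PEnv Lbl Δ} {Γ : Env Lbl Δ} {i : ℕ} {τ υ : Ty Lbl Δ (.star i)} :
      Tm Φ Γ τ → TyEq τ υ → Tm Φ Γ υ
  /-- A term of a type of level `i` is a term of the same type at level `j`. -/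
  | up {Δ : KEnv} {Φ : PEnv Lbl Δ} {Γ : Env Lbl Δ} {i j : ℕ} (h : i ≤ j)
      {τ : Ty Lbl Δ (.star i)} : Tm Φ Γ τ → Tm Φ Γ (.up h τ)
  | down {Δ : KEnv} {Φ : PEnv Lbl Δ} {Γ : Env Lbl Δ} {i j : ℕ} {h : i ≤ j}
      {τ : Ty Lbl Δ (.star i)} : Tm Φ Γ (.up h τ) → Tm Φ Γ τ
  | plam {Δ : KEnv} {Φ : PEnv Lbl Δ} {Γ : Env Lbl Δ} {κ : Kind} {k : ℕ} (h : κ.level < k)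
      {π : Pred Lbl Δ κ} {τ : Ty Lbl Δ (.star k)} : Tm (Φ.cons π) Γ τ → Tm Φ Γ (.imp h π τ)
  | papp {Δ : KEnv} {Φ : PEnv Lbl Δ} {Γ : Env Lbl Δ} {κ : Kind} {k : ℕ} {h : κ.level < k}
      {π : Pred Lbl Δ κ} {τ : Ty Lbl Δ (.star k)} : Tm Φ Γ (.imp h π τ) → Ent Φ π → Tm Φ Γ τ
  | tlam {Δ : KEnv} {Φ : PEnv Lbl Δ} {Γ : Env Lbl Δ} {κ : Kind} {k : ℕ} (h : κ.level < k)
      {τ : Ty Lbl (κ :: Δ) (.star k)} : Tm Φ.wk Γ.wk τ → Tm Φ Γ (.all κ h τ)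
  | tapp {Δ : KEnv} {Φ : PEnv Lbl Δ} {Γ : Env Lbl Δ} {κ : Kind} {k : ℕ} {h : κ.level < k}
      {τ : Ty Lbl (κ :: Δ) (.star k)} : Tm Φ Γ (.all κ h τ) → (υ : Ty Lbl Δ κ) →
      Tm Φ Γ (τ.inst υ)
  | lab {Δ : KEnv} {Φ : PEnv Lbl Δ} {Γ : Env Lbl Δ} (l : Lbl) : Tm Φ Γ (.sing (.lab l))
  | label {Δ : KEnv} {Φ : PEnv Lbl Δ} {Γ : Env Lbl Δ} {i : ℕ} {ξ : Ty Lbl Δ .lab}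
      {τ : Ty Lbl Δ (.star i)} : Tm Φ Γ (.sing ξ) → Tm Φ Γ τ → Tm Φ Γ (.lty ξ τ)
  | unlabel {Δ : KEnv} {Φ : PEnv Lbl Δ} {Γ : Env Lbl Δ} {i : ℕ} {ξ : Ty Lbl Δ .lab}
      {τ : Ty Lbl Δ (.star i)} : Tm Φ Γ (.lty ξ τ) → Tm Φ Γ (.sing ξ) → Tm Φ Γ τ
  | prj {Δ : KEnv} {Φ : PEnv Lbl Δ} {Γ : Env Lbl Δ} {i : ℕ} {d : Dir}
      {ρ₁ ρ₂ : Ty Lbl Δ (.row (.star i))} : Tm Φ Γ (.pi ρ₁) → Ent Φ (.leq d ρ₂ ρ₁) →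
      Tm Φ Γ (.pi ρ₂)
  | cat {Δ : KEnv} {Φ : PEnv Lbl Δ} {Γ : Env Lbl Δ} {i : ℕ}
      {ρ₁ ρ₂ ρ₃ : Ty Lbl Δ (.row (.star i))} : Tm Φ Γ (.pi ρ₁) → Tm Φ Γ (.pi ρ₂) →
      Ent Φ (.plus ρ₁ ρ₂ ρ₃) → Tm Φ Γ (.pi ρ₃)
  | inj {Δ : KEnv} {Φ : PEnv Lbl Δ} {Γ : Env Lbl Δ} {i : ℕ} {d : Dir}
      {ρ₁ ρ₂ : Ty Lbl Δ (.row (.star i))} : Tm Φ Γ (.sigma ρ₁) → Ent Φ (.leq d ρ₁ ρ₂) →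
      Tm Φ Γ (.sigma ρ₂)
  | branch {Δ : KEnv} {Φ : PEnv Lbl Δ} {Γ : Env Lbl Δ} {i k : ℕ} {h : i ≤ k}
      {ρ₁ ρ₂ ρ₃ : Ty Lbl Δ (.row (.star i))} {τ : Ty Lbl Δ (.star k)} :
      Tm Φ Γ ((Ty.up h (.sigma ρ₁)).fn τ) → Tm Φ Γ ((Ty.up h (.sigma ρ₂)).fn τ) →
      Ent Φ (.plus ρ₁ ρ₂ ρ₃) → Tm Φ Γ ((Ty.up h (.sigma ρ₃)).fn τ)
  /-- Construction and deconstruction of singleton records and variants. -/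
  | piSingle {Δ : KEnv} {Φ : PEnv Lbl Δ} {Γ : Env Lbl Δ} {i : ℕ} {ξ : Ty Lbl Δ .lab}
      {τ : Ty Lbl Δ (.star i)} : Tm Φ Γ (.lty ξ τ) → Tm Φ Γ (.pi (.row ξ τ))
  | piUnsingle {Δ : KEnv} {Φ : PEnv Lbl Δ} {Γ : Env Lbl Δ} {i : ℕ} {ξ : Ty Lbl Δ .lab}
      {τ : Ty Lbl Δ (.star i)} : Tm Φ Γ (.pi (.row ξ τ)) → Tm Φ Γ (.lty ξ τ)
  | sigmaSingle {Δ : KEnv} {Φ : PEnv Lbl Δ} {Γ : Env Lbl Δ} {i : ℕ} {ξ : Ty Lbl Δ .lab}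
      {τ : Ty Lbl Δ (.star i)} : Tm Φ Γ (.lty ξ τ) → Tm Φ Γ (.sigma (.row ξ τ))
  | sigmaUnsingle {Δ : KEnv} {Φ : PEnv Lbl Δ} {Γ : Env Lbl Δ} {i : ℕ} {ξ : Ty Lbl Δ .lab}
      {τ : Ty Lbl Δ (.star i)} : Tm Φ Γ (.sigma (.row ξ τ)) → Tm Φ Γ (.lty ξ τ)
  | ana {Δ : KEnv} {Φ : PEnv Lbl Δ} {Γ : Env Lbl Δ} {κ : Kind} {i k m : ℕ} (h : κ.level < m)
      (hi : i ≤ k) (hk : k ≤ m) (ρ : Ty Lbl Δ (.row κ)) (φ : Ty Lbl Δ (.arr κ (.star i)))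
      {τ : Ty Lbl Δ (.star k)} :
      Tm Φ Γ (Ty.generic h ρ
        ((Ty.up (hi.trans hk) (.app φ.wkGeneric .genericU)).fn (.up hk τ.wkGeneric))) →
      Tm Φ Γ ((Ty.up hi (.sigma (.lift₂ φ ρ))).fn τ)
  | syn {Δ : KEnv} {Φ : PEnv Lbl Δ} {Γ : Env Lbl Δ} {κ : Kind} {i m : ℕ} (h : κ.level < m)
      (hi : i ≤ m) (ρ : Ty Lbl Δ (.row κ)) (φ : Ty Lbl Δ (.arr κ (.star i))) :
      Tm Φ Γ (Ty.generic h ρ (.up hi (.app φ.wkGeneric .genericU))) →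
      Tm Φ Γ (.pi (.lift₂ φ ρ))
  | fold {Δ : KEnv} {Φ : PEnv Lbl Δ} {Γ : Env Lbl Δ} {i k m : ℕ} (h : (Kind.star i).level < m)
      (hi : i ≤ m) (hk : k ≤ m) {ρ : Ty Lbl Δ (.row (.star i))} {τ : Ty Lbl Δ (.star k)} :
      Tm Φ Γ (Ty.generic h ρ ((Ty.up hi .genericU).fn (.up hk τ.wkGeneric))) →
      Tm Φ Γ (τ.fn (τ.fn τ)) → Tm Φ Γ τ → Tm Φ Γ (.pi ρ) → Tm Φ Γ τ

/-! # Interpretation of types, predicates and environments -/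

/-- The interpretation of kinding environments: tuples. -/
def KEnv.Interp : KEnv → Type (u + 1)
  | [] => PUnit
  | κ :: Δ => KEnv.Interp Δ × κ.Interp

def TVar.lookup {κ : Kind} : {Δ : KEnv} → TVar Δ κ → KEnv.Interp.{u} Δ → κ.Interp
  | _, .zero, H => H.2
  | _, .succ x, H => x.lookup H.1

section Interpretation

variable {Lbl : Type}

mutual

/-- The interpretation of types. -/
def Ty.interp {Δ : KEnv} {κ : Kind} : Ty Lbl Δ κ → KEnv.Interp.{u} Δ → κ.Interp
  | .var x, H => x.lookup H
  | .up h τ, H => Univ.up h (τ.interp H)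
  | .arr _, _ => fun a b => Code.arr a b
  | .imp _ π τ, H => Code.imp (π.interp H).Evidence (τ.interp H)
  | .all κ h τ, H => Univ.all κ h fun X => τ.interp (H, X)
  | .lam _ τ, H => fun X => τ.interp (H, X)
  | .app φ τ, H => (φ.interp H) (τ.interp H)
  | .lab _, _ => PUnit.unit
  | .sing _, _ => Code.unit
  | .lty _ τ, H => τ.interp H
  | .row _ τ, H => Row.single (τ.interp H)
  | .pi ρ, H => piOp _ (ρ.interp H)
  | .sigma ρ, H => sigmaOp _ (ρ.interp H)
  | .lift₁ ρ τ, H => Row.map (fun f => f (τ.interp H)) (ρ.interp H)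
  | .lift₂ φ ρ, H => Row.map (φ.interp H) (ρ.interp H)

/-- The interpretation of predicates; the direction of a containment plays no role. -/
def Pred.interp {Δ : KEnv} {κ : Kind} : Pred Lbl Δ κ → KEnv.Interp.{u} Δ → RowPred κ.Interp
  | .leq _ ρ₁ ρ₂, H => .leq (ρ₁.interp H) (ρ₂.interp H)
  | .plus ρ₁ ρ₂ ρ₃, H => .plus (ρ₁.interp H) (ρ₂.interp H) (ρ₃.interp H)

end

/-- The evidence for the interpretation of a predicate. -/
abbrev Pred.Interp {Δ : KEnv} {κ : Kind} (π : Pred Lbl Δ κ) (H : KEnv.Interp.{u} Δ) : Type :=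
  (π.interp H).Evidence

/-- The elements of the interpretation of a type of base kind. -/
abbrev Ty.El {Δ : KEnv} {i : ℕ} (τ : Ty Lbl Δ (.star i)) (H : KEnv.Interp.{u} Δ) : Type (u + 1) :=
  Univ.El (τ.interp H)

/-- The interpretation of predicate environments: tuples of evidence. -/
def PEnv.Interp {Δ : KEnv} : PEnv Lbl Δ → KEnv.Interp.{u} Δ → Type
  | .nil, _ => PUnit
  | .cons Φ π, H => Φ.Interp H × π.Interp H

def PVar.lookup {Δ : KEnv} {κ : Kind} {π : Pred Lbl Δ κ} {H : KEnv.Interp.{u} Δ} :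
    {Φ : PEnv Lbl Δ} → PVar Φ π → Φ.Interp H → π.Interp H
  | _, .zero, e => e.2
  | _, .succ x, e => x.lookup e.1

/-- The interpretation of typing environments: tuples of elements. -/
def Env.Interp {Δ : KEnv} : Env Lbl Δ → KEnv.Interp.{u} Δ → Type (u + 1)
  | .nil, _ => PUnit
  | .cons Γ τ, H => Γ.Interp H × τ.El H

def EVar.lookup {Δ : KEnv} {i : ℕ} {τ : Ty Lbl Δ (.star i)} {H : KEnv.Interp.{u} Δ} :
    {Γ : Env Lbl Δ} → EVar Γ τ → Γ.Interp H → τ.El H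
  | _, .zero, g => g.2
  | _, .succ x, g => x.lookup g.1

end Interpretation

/-! # Denotations

The clauses below relate elements of types that are equal, but not definitionally so
(because of weakening, substitution, type equivalence or cumulativity), by heterogeneous equality:
`f ≍ x` says that the types of `f` and `x` are equal and that `f` is `x` under this
identification. -/

/-- Assignments of evidence to entailment derivations. -/
abbrev EntDen (Lbl : Type) : Type (u + 1) :=
  ∀ {Δ : KEnv} {Φ : PEnv Lbl Δ} {κ : Kind} {π : Pred Lbl Δ κ}, Ent Φ π →
    (H : KEnv.Interp.{u} Δ) → Φ.Interp H → π.Interp H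

/-- Assignments of an element of the interpreted type to each term, given interpretations of the
kind, predicate and typing environments. -/
abbrev TmDen (Lbl : Type) : Type (u + 1) :=
  ∀ {Δ : KEnv} {Φ : PEnv Lbl Δ} {Γ : Env Lbl Δ} {i : ℕ} {τ : Ty Lbl Δ (.star i)}, Tm Φ Γ τ →
    (H : KEnv.Interp.{u} Δ) → Φ.Interp H → Γ.Interp H → τ.El H

/-- The compositional clauses for the denotation of entailment derivations. -/
structure IsEntDen {Lbl : Type} (D : EntDen.{u} Lbl) : Prop where
  ax : ∀ {Δ : KEnv} {Φ : PEnv Lbl Δ} {κ : Kind} {π : Pred Lbl Δ κ} (x : PVar Φ π)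
    (H : KEnv.Interp.{u} Δ) (e : Φ.Interp H), D (.ax x) H e = x.lookup e
  refl : ∀ {Δ : KEnv} {Φ : PEnv Lbl Δ} {κ : Kind} (d : Dir) (ρ : Ty Lbl Δ (.row κ))
    (H : KEnv.Interp.{u} Δ) (e : Φ.Interp H), D (.refl d ρ) H e = Leq.refl (ρ.interp H)
  trans : ∀ {Δ : KEnv} {Φ : PEnv Lbl Δ} {κ : Kind} {d : Dir} {ρ₁ ρ₂ ρ₃ : Ty Lbl Δ (.row κ)}
    (p : Ent Φ (.leq d ρ₁ ρ₂)) (q : Ent Φ (.leq d ρ₂ ρ₃))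
    (H : KEnv.Interp.{u} Δ) (e : Φ.Interp H), D (p.trans q) H e = Leq.trans (D p H e) (D q H e)
  conv : ∀ {Δ : KEnv} {Φ : PEnv Lbl Δ} {κ : Kind} {π₁ π₂ : Pred Lbl Δ κ} (p : Ent Φ π₁)
    (h : PredEq π₁ π₂) (H : KEnv.Interp.{u} Δ) (e : Φ.Interp H), D (p.conv h) H e ≍ D p H e
  leqLift₁ : ∀ {Δ : KEnv} {Φ : PEnv Lbl Δ} {κ₁ κ₂ : Kind} {d : Dir}
    {ρ₁ ρ₂ : Ty Lbl Δ (.row κ₁)} (φ : Ty Lbl Δ (.arr κ₁ κ₂)) (p : Ent Φ (.leq d ρ₁ ρ₂))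
    (H : KEnv.Interp.{u} Δ) (e : Φ.Interp H),
    D (p.leqLift₁ φ) H e = Leq.map (φ.interp H) (D p H e)
  leqLift₂ : ∀ {Δ : KEnv} {Φ : PEnv Lbl Δ} {κ₁ κ₂ : Kind} {d : Dir}
    {ρ₁ ρ₂ : Ty Lbl Δ (.row (.arr κ₁ κ₂))} (τ : Ty Lbl Δ κ₁) (p : Ent Φ (.leq d ρ₁ ρ₂))
    (H : KEnv.Interp.{u} Δ) (e : Φ.Interp H),
    D (p.leqLift₂ τ) H e = Leq.map (fun f => f (τ.interp H)) (D p H e)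
  plusLift₁ : ∀ {Δ : KEnv} {Φ : PEnv Lbl Δ} {κ₁ κ₂ : Kind}
    {ρ₁ ρ₂ ρ₃ : Ty Lbl Δ (.row (.arr κ₁ κ₂))} (τ : Ty Lbl Δ κ₁) (p : Ent Φ (.plus ρ₁ ρ₂ ρ₃))
    (H : KEnv.Interp.{u} Δ) (e : Φ.Interp H),
    D (p.plusLift₁ τ) H e = Plus.map (fun f => f (τ.interp H)) (D p H e)
  plusLift₂ : ∀ {Δ : KEnv} {Φ : PEnv Lbl Δ} {κ₁ κ₂ : Kind}
    {ρ₁ ρ₂ ρ₃ : Ty Lbl Δ (.row κ₁)} (φ : Ty Lbl Δ (.arr κ₁ κ₂)) (p : Ent Φ (.plus ρ₁ ρ₂ ρ₃))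
    (H : KEnv.Interp.{u} Δ) (e : Φ.Interp H),
    D (p.plusLift₂ φ) H e = Plus.map (φ.interp H) (D p H e)
  plusLeft : ∀ {Δ : KEnv} {Φ : PEnv Lbl Δ} {κ : Kind} {ρ₁ ρ₂ ρ₃ : Ty Lbl Δ (.row κ)}
    (p : Ent Φ (.plus ρ₁ ρ₂ ρ₃)) (H : KEnv.Interp.{u} Δ) (e : Φ.Interp H),
    D p.plusLeft H e = Plus.left (D p H e)
  plusRight : ∀ {Δ : KEnv} {Φ : PEnv Lbl Δ} {κ : Kind} {ρ₁ ρ₂ ρ₃ : Ty Lbl Δ (.row κ)}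
    (p : Ent Φ (.plus ρ₁ ρ₂ ρ₃)) (H : KEnv.Interp.{u} Δ) (e : Φ.Interp H),
    D p.plusRight H e = Plus.right (D p H e)

/-- The compositional clauses for the denotation of terms, over a denotation of entailment
derivations. -/
structure IsTmDen {Lbl : Type} (E : EntDen.{u} Lbl) (D : TmDen.{u} Lbl) : Prop where
  var : ∀ {Δ : KEnv} {Φ : PEnv Lbl Δ} {Γ : Env Lbl Δ} {i : ℕ} {τ : Ty Lbl Δ (.star i)}
    (x : EVar Γ τ) (H : KEnv.Interp.{u} Δ) (e : Φ.Interp H) (g : Γ.Interp H),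
    D (Tm.var (Φ := Φ) x) H e g = x.lookup g
  lam : ∀ {Δ : KEnv} {Φ : PEnv Lbl Δ} {Γ : Env Lbl Δ} {i : ℕ} {τ υ : Ty Lbl Δ (.star i)}
    (M : Tm Φ (Γ.cons τ) υ) (H : KEnv.Interp.{u} Δ) (e : Φ.Interp H) (g : Γ.Interp H),
    D M.lam H e g = fun x : τ.El H => D M H e (g, x)
  app : ∀ {Δ : KEnv} {Φ : PEnv Lbl Δ} {Γ : Env Lbl Δ} {i : ℕ} {τ υ : Ty Lbl Δ (.star i)}
    (M : Tm Φ Γ (τ.fn υ)) (N : Tm Φ Γ τ) (H : KEnv.Interp.{u} Δ) (e : Φ.Interp H)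
    (g : Γ.Interp H),
    D (M.app N) H e g = (D M H e g : τ.El H → υ.El H) (D N H e g)
  conv : ∀ {Δ : KEnv} {Φ : PEnv Lbl Δ} {Γ : Env Lbl Δ} {i : ℕ} {τ υ : Ty Lbl Δ (.star i)}
    (M : Tm Φ Γ τ) (h : TyEq τ υ) (H : KEnv.Interp.{u} Δ) (e : Φ.Interp H) (g : Γ.Interp H),
    D (M.conv h) H e g ≍ D M H e g
  up : ∀ {Δ : KEnv} {Φ : PEnv Lbl Δ} {Γ : Env Lbl Δ} {i j : ℕ} (h : i ≤ j)
    {τ : Ty Lbl Δ (.star i)} (M : Tm Φ Γ τ) (H : KEnv.Interp.{u} Δ) (e : Φ.Interp H)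
    (g : Γ.Interp H), D (M.up h) H e g ≍ D M H e g
  down : ∀ {Δ : KEnv} {Φ : PEnv Lbl Δ} {Γ : Env Lbl Δ} {i j : ℕ} {h : i ≤ j}
    {τ : Ty Lbl Δ (.star i)} (M : Tm Φ Γ (.up h τ)) (H : KEnv.Interp.{u} Δ) (e : Φ.Interp H)
    (g : Γ.Interp H), D M.down H e g ≍ D M H e g
  plam : ∀ {Δ : KEnv} {Φ : PEnv Lbl Δ} {Γ : Env Lbl Δ} {κ : Kind} {k : ℕ} (h : κ.level < k)
    {π : Pred Lbl Δ κ} {τ : Ty Lbl Δ (.star k)} (M : Tm (Φ.cons π) Γ τ)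
    (H : KEnv.Interp.{u} Δ) (e : Φ.Interp H) (g : Γ.Interp H),
    D (M.plam h) H e g = fun p : π.Interp H => D M H (e, p) g
  papp : ∀ {Δ : KEnv} {Φ : PEnv Lbl Δ} {Γ : Env Lbl Δ} {κ : Kind} {k : ℕ} {h : κ.level < k}
    {π : Pred Lbl Δ κ} {τ : Ty Lbl Δ (.star k)} (M : Tm Φ Γ (.imp h π τ)) (p : Ent Φ π)
    (H : KEnv.Interp.{u} Δ) (e : Φ.Interp H) (g : Γ.Interp H),
    D (M.papp p) H e g = (D M H e g : π.Interp H → τ.El H) (E p H e)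
  tlam : ∀ {Δ : KEnv} {Φ : PEnv Lbl Δ} {Γ : Env Lbl Δ} {κ : Kind} {k : ℕ} (h : κ.level < k)
    {τ : Ty Lbl (κ :: Δ) (.star k)} (M : Tm Φ.wk Γ.wk τ)
    (H : KEnv.Interp.{u} Δ) (e : Φ.Interp H) (g : Γ.Interp H),
    ∃ f : (X : κ.Interp) → τ.El (H, X), f ≍ D (M.tlam h) H e g ∧
      ∀ X : κ.Interp, ∃ (e' : Φ.wk.Interp (H, X)) (g' : Γ.wk.Interp (H, X)),
        e' ≍ e ∧ g' ≍ g ∧ f X = D M (H, X) e' g'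
  tapp : ∀ {Δ : KEnv} {Φ : PEnv Lbl Δ} {Γ : Env Lbl Δ} {κ : Kind} {k : ℕ} {h : κ.level < k}
    {τ : Ty Lbl (κ :: Δ) (.star k)} (M : Tm Φ Γ (.all κ h τ)) (υ : Ty Lbl Δ κ)
    (H : KEnv.Interp.{u} Δ) (e : Φ.Interp H) (g : Γ.Interp H),
    ∃ f : (X : κ.Interp) → τ.El (H, X), f ≍ D M H e g ∧
      D (M.tapp υ) H e g ≍ f (υ.interp H)
  lab : ∀ {Δ : KEnv} {Φ : PEnv Lbl Δ} {Γ : Env Lbl Δ} (l : Lbl)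
    (H : KEnv.Interp.{u} Δ) (e : Φ.Interp H) (g : Γ.Interp H),
    D (Tm.lab (Φ := Φ) (Γ := Γ) l) H e g = PUnit.unit
  label : ∀ {Δ : KEnv} {Φ : PEnv Lbl Δ} {Γ : Env Lbl Δ} {i : ℕ} {ξ : Ty Lbl Δ .lab}
    {τ : Ty Lbl Δ (.star i)} (M : Tm Φ Γ (.sing ξ)) (N : Tm Φ Γ τ)
    (H : KEnv.Interp.{u} Δ) (e : Φ.Interp H) (g : Γ.Interp H),
    D (M.label N) H e g = D N H e g
  unlabel : ∀ {Δ : KEnv} {Φ : PEnv Lbl Δ} {Γ : Env Lbl Δ} {i : ℕ} {ξ : Ty Lbl Δ .lab}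
    {τ : Ty Lbl Δ (.star i)} (M : Tm Φ Γ (.lty ξ τ)) (N : Tm Φ Γ (.sing ξ))
    (H : KEnv.Interp.{u} Δ) (e : Φ.Interp H) (g : Γ.Interp H),
    D (M.unlabel N) H e g = D M H e g
  prj : ∀ {Δ : KEnv} {Φ : PEnv Lbl Δ} {Γ : Env Lbl Δ} {i : ℕ} {d : Dir}
    {ρ₁ ρ₂ : Ty Lbl Δ (.row (.star i))} (M : Tm Φ Γ (.pi ρ₁)) (p : Ent Φ (.leq d ρ₂ ρ₁))
    (H : KEnv.Interp.{u} Δ) (e : Φ.Interp H) (g : Γ.Interp H),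
    D (M.prj p) H e g = Rec.prj (F := Univ.El) (E p H e) (D M H e g)
  cat : ∀ {Δ : KEnv} {Φ : PEnv Lbl Δ} {Γ : Env Lbl Δ} {i : ℕ}
    {ρ₁ ρ₂ ρ₃ : Ty Lbl Δ (.row (.star i))} (M : Tm Φ Γ (.pi ρ₁)) (N : Tm Φ Γ (.pi ρ₂))
    (p : Ent Φ (.plus ρ₁ ρ₂ ρ₃)) (H : KEnv.Interp.{u} Δ) (e : Φ.Interp H) (g : Γ.Interp H),
    D (M.cat N p) H e g = Rec.cat (F := Univ.El) (E p H e) (D M H e g) (D N H e g)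
  inj : ∀ {Δ : KEnv} {Φ : PEnv Lbl Δ} {Γ : Env Lbl Δ} {i : ℕ} {d : Dir}
    {ρ₁ ρ₂ : Ty Lbl Δ (.row (.star i))} (M : Tm Φ Γ (.sigma ρ₁)) (p : Ent Φ (.leq d ρ₁ ρ₂))
    (H : KEnv.Interp.{u} Δ) (e : Φ.Interp H) (g : Γ.Interp H),
    D (M.inj p) H e g = Var.inj (F := Univ.El) (E p H e) (D M H e g)
  branch : ∀ {Δ : KEnv} {Φ : PEnv Lbl Δ} {Γ : Env Lbl Δ} {i k : ℕ} {h : i ≤ k}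
    {ρ₁ ρ₂ ρ₃ : Ty Lbl Δ (.row (.star i))} {τ : Ty Lbl Δ (.star k)}
    (M : Tm Φ Γ ((Ty.up h (.sigma ρ₁)).fn τ)) (N : Tm Φ Γ ((Ty.up h (.sigma ρ₂)).fn τ))
    (p : Ent Φ (.plus ρ₁ ρ₂ ρ₃)) (H : KEnv.Interp.{u} Δ) (e : Φ.Interp H) (g : Γ.Interp H),
    D (M.branch N p) H e g =
      Var.branch (F := fun a => Univ.El (Univ.up h a)) (T := τ.El H) (E p H e) (D M H e g) (D N H e g)
  piSingle : ∀ {Δ : KEnv} {Φ : PEnv Lbl Δ} {Γ : Env Lbl Δ} {i : ℕ} {ξ : Ty Lbl Δ .lab}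
    {τ : Ty Lbl Δ (.star i)} (M : Tm Φ Γ (.lty ξ τ))
    (H : KEnv.Interp.{u} Δ) (e : Φ.Interp H) (g : Γ.Interp H),
    D M.piSingle H e g = fun _ : Fin 1 => (D M H e g : τ.El H)
  piUnsingle : ∀ {Δ : KEnv} {Φ : PEnv Lbl Δ} {Γ : Env Lbl Δ} {i : ℕ} {ξ : Ty Lbl Δ .lab}
    {τ : Ty Lbl Δ (.star i)} (M : Tm Φ Γ (.pi (.row ξ τ)))
    (H : KEnv.Interp.{u} Δ) (e : Φ.Interp H) (g : Γ.Interp H),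
    D M.piUnsingle H e g = (D M H e g : Fin 1 → τ.El H) (0 : Fin 1)
  sigmaSingle : ∀ {Δ : KEnv} {Φ : PEnv Lbl Δ} {Γ : Env Lbl Δ} {i : ℕ} {ξ : Ty Lbl Δ .lab}
    {τ : Ty Lbl Δ (.star i)} (M : Tm Φ Γ (.lty ξ τ))
    (H : KEnv.Interp.{u} Δ) (e : Φ.Interp H) (g : Γ.Interp H),
    D M.sigmaSingle H e g = (⟨(0 : Fin 1), D M H e g⟩ : (_ : Fin 1) × τ.El H)
  sigmaUnsingle : ∀ {Δ : KEnv} {Φ : PEnv Lbl Δ} {Γ : Env Lbl Δ} {i : ℕ} {ξ : Ty Lbl Δ .lab}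
    {τ : Ty Lbl Δ (.star i)} (M : Tm Φ Γ (.sigma (.row ξ τ)))
    (H : KEnv.Interp.{u} Δ) (e : Φ.Interp H) (g : Γ.Interp H),
    D M.sigmaUnsingle H e g = (D M H e g : (_ : Fin 1) × τ.El H).2
  ana : ∀ {Δ : KEnv} {Φ : PEnv Lbl Δ} {Γ : Env Lbl Δ} {κ : Kind} {i k m : ℕ} (h : κ.level < m)
    (hi : i ≤ k) (hk : k ≤ m) (ρ : Ty Lbl Δ (.row κ)) (φ : Ty Lbl Δ (.arr κ (.star i)))
    {τ : Ty Lbl Δ (.star k)}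
    (M : Tm Φ Γ (Ty.generic h ρ
      ((Ty.up (hi.trans hk) (.app φ.wkGeneric .genericU)).fn (.up hk τ.wkGeneric))))
    (H : KEnv.Interp.{u} Δ) (e : Φ.Interp H) (g : Γ.Interp H),
    ∃ f : Generic (A := κ.Interp) (ρ.interp H) fun a => Univ.El (φ.interp H a) → τ.El H,
      f ≍ D M H e g ∧ D (Tm.ana h hi hk ρ φ M) H e g ≍ f.ana
  syn : ∀ {Δ : KEnv} {Φ : PEnv Lbl Δ} {Γ : Env Lbl Δ} {κ : Kind} {i m : ℕ} (h : κ.level < m)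
    (hi : i ≤ m) (ρ : Ty Lbl Δ (.row κ)) (φ : Ty Lbl Δ (.arr κ (.star i)))
    (M : Tm Φ Γ (Ty.generic h ρ (.up hi (.app φ.wkGeneric .genericU))))
    (H : KEnv.Interp.{u} Δ) (e : Φ.Interp H) (g : Γ.Interp H),
    ∃ f : Generic (A := κ.Interp) (ρ.interp H) fun a => Univ.El (φ.interp H a),
      f ≍ D M H e g ∧ D (Tm.syn h hi ρ φ M) H e g = f.syn
  fold : ∀ {Δ : KEnv} {Φ : PEnv Lbl Δ} {Γ : Env Lbl Δ} {i k m : ℕ}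
    (h : (Kind.star i).level < m) (hi : i ≤ m) (hk : k ≤ m) {ρ : Ty Lbl Δ (.row (.star i))}
    {τ : Ty Lbl Δ (.star k)}
    (M₁ : Tm Φ Γ (Ty.generic h ρ ((Ty.up hi .genericU).fn (.up hk τ.wkGeneric))))
    (M₂ : Tm Φ Γ (τ.fn (τ.fn τ))) (M₃ : Tm Φ Γ τ) (N : Tm Φ Γ (.pi ρ))
    (H : KEnv.Interp.{u} Δ) (e : Φ.Interp H) (g : Γ.Interp H),
    ∃ f : Generic (A := Univ.{u} i) (ρ.interp H) fun a => Univ.El a → τ.El H,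
      f ≍ D M₁ H e g ∧
      D (Tm.fold h hi hk M₁ M₂ M₃ N) H e g =
        f.fold (F := Univ.El) (D M₂ H e g) (D M₃ H e g) (D N H e g)

end ROmega

namespace ROmega

/-! # Cumulativity -/

namespace Univ

theorem el_up {i j : ℕ} (h : i ≤ j) : ∀ a : Univ.{u} i, El (up h a) = El a
  | .base _ => rfl
  | .unit => rfl
  | .arr a b => by
      change (El (up h a) → El (up h b)) = (El a → El b)
      rw [el_up h a, el_up h b]
  | .pi k f => by
      change ((x : Fin k) → El (up h (f x))) = ((x : Fin k) → El (f x))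
      exact pi_congr fun x => el_up h (f x)
  | .sigma k f => by
      change ((x : Fin k) × El (up h (f x))) = ((x : Fin k) × El (f x))
      exact congrArg Sigma (funext fun x => el_up h (f x))
  | .imp E a => by
      change (E → El (up h a)) = (E → El a)
      rw [el_up h a]
  | Code.all κ f => by
      change ((X : κ.1.Interp) → El (up h (f (cast κ.1.interp_eq.symm X)))) =
        ((X : κ.1.Interp) → El (f (cast κ.1.interp_eq.symm X)))
      exact pi_congr fun X => el_up h (f _)

theorem up_refl {i : ℕ} (h : i ≤ i) : ∀ a : Univ.{u} i, up h a = a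
  | .base _ => rfl
  | .unit => rfl
  | .arr a b => congrArg₂ Code.arr (up_refl h a) (up_refl h b)
  | .pi k f => congrArg (Code.pi k) (funext fun x => up_refl h (f x))
  | .sigma k f => congrArg (Code.sigma k) (funext fun x => up_refl h (f x))
  | .imp E a => congrArg (Code.imp E) (up_refl h a)
  | Code.all κ f => congrArg (Code.all κ) (funext fun X => up_refl h (f X))

theorem up_up {i j k : ℕ} (h : i ≤ j) (h' : j ≤ k) :
    ∀ a : Univ.{u} i, up h' (up h a) = up (h.trans h') a
  | .base _ => rfl
  | .unit => rfl
  | .arr a b => congrArg₂ Code.arr (up_up h h' a) (up_up h h' b)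
  | .pi k f => congrArg (Code.pi k) (funext fun x => up_up h h' (f x))
  | .sigma k f => congrArg (Code.sigma k) (funext fun x => up_up h h' (f x))
  | .imp E a => congrArg (Code.imp E) (up_up h h' a)
  | Code.all _ f => congrArg (Code.all _) (funext fun X => up_up h h' (f X))

theorem el_all {n : ℕ} (κ : Kind) (h : κ.level < n) (f : κ.Interp → Univ.{u} n) :
    El (all κ h f) = ((X : κ.Interp) → El (f X)) := by
  change ((X : κ.Interp) → El (f (cast κ.interp_eq (cast κ.interp_eq.symm X)))) = _
  exact pi_congr fun X => congrArg (fun Y => El (f Y)) (cast_cast _ _ X)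

end Univ

/-! # Renaming and substitution -/

section Substitution

variable {Lbl : Type}

/-- `H` is the environment obtained from `H'` by the renaming `r`. -/
def Ren.Respects {Δ Δ' : KEnv} (r : Ren Δ Δ') (H : KEnv.Interp.{u} Δ) (H' : KEnv.Interp.{u} Δ') :
    Prop :=
  ∀ (κ : Kind) (x : TVar Δ κ), (r κ x).lookup H' = x.lookup H

theorem Ren.Respects.lift {Δ Δ' : KEnv} {r : Ren Δ Δ'} {H : KEnv.Interp.{u} Δ}
    {H' : KEnv.Interp.{u} Δ'} (hr : r.Respects H H') {κ' : Kind} (X : κ'.Interp) :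
    (r.lift κ').Respects (Δ := κ' :: Δ) (Δ' := κ' :: Δ') (H, X) (H', X)
  | _, .zero => rfl
  | _, .succ x => hr _ x

mutual

theorem Ty.interp_rename {Δ Δ' : KEnv} {κ : Kind} (r : Ren Δ Δ') (H : KEnv.Interp.{u} Δ)
    (H' : KEnv.Interp.{u} Δ') (hr : r.Respects H H') :
    ∀ τ : Ty Lbl Δ κ, (τ.rename r).interp H' = τ.interp H
  | .var x => hr _ x
  | .up h τ => congrArg (Univ.up h) (τ.interp_rename r H H' hr)
  | .arr _ => rfl
  | .imp _ π τ => congrArg₂ (fun p a => Code.imp (RowPred.Evidence p) a)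
      (π.interp_rename r H H' hr) (τ.interp_rename r H H' hr)
  | .all κ h τ => congrArg (Univ.all κ h)
      (funext fun X => τ.interp_rename (r.lift κ) (H, X) (H', X) (hr.lift X))
  | .lam κ τ => funext fun X => τ.interp_rename (r.lift κ) (H, X) (H', X) (hr.lift X)
  | .app φ τ => congr (φ.interp_rename r H H' hr) (τ.interp_rename r H H' hr)
  | .lab _ => rfl
  | .sing _ => rfl
  | .lty _ τ => τ.interp_rename r H H' hr
  | .row _ τ => congrArg Row.single (τ.interp_rename r H H' hr)
  | .pi ρ => congrArg (piOp _) (ρ.interp_rename r H H' hr)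
  | .sigma ρ => congrArg (sigmaOp _) (ρ.interp_rename r H H' hr)
  | .lift₁ (κ₁ := κ₁) (κ₂ := κ₂) ρ τ => congrArg₂
      (fun R X => Row.map (fun f : (Kind.arr κ₁ κ₂).Interp => f X) R)
      (ρ.interp_rename r H H' hr) (τ.interp_rename r H H' hr)
  | .lift₂ φ ρ => congrArg₂ Row.map (φ.interp_rename r H H' hr) (ρ.interp_rename r H H' hr)

theorem Pred.interp_rename {Δ Δ' : KEnv} {κ : Kind} (r : Ren Δ Δ') (H : KEnv.Interp.{u} Δ)
    (H' : KEnv.Interp.{u} Δ') (hr : r.Respects H H') :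
    ∀ π : Pred Lbl Δ κ, (π.rename r).interp H' = π.interp H
  | .leq _ ρ₁ ρ₂ => congrArg₂ RowPred.leq (ρ₁.interp_rename r H H' hr) (ρ₂.interp_rename r H H' hr)
  | .plus ρ₁ ρ₂ ρ₃ => congr (congrArg₂ RowPred.plus (ρ₁.interp_rename r H H' hr)
      (ρ₂.interp_rename r H H' hr)) (ρ₃.interp_rename r H H' hr)

end

theorem Ty.interp_wk {Δ : KEnv} {κ κ' : Kind} (τ : Ty Lbl Δ κ) (H : KEnv.Interp.{u} Δ)
    (X : κ'.Interp) : τ.wk.interp (Δ := κ' :: Δ) (H, X) = τ.interp H :=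
  τ.interp_rename _ H (show KEnv.Interp (κ' :: Δ) from (H, X)) fun _ _ => rfl

theorem Pred.interp_wk {Δ : KEnv} {κ κ' : Kind} (π : Pred Lbl Δ κ) (H : KEnv.Interp.{u} Δ)
    (X : κ'.Interp) : π.wk.interp (Δ := κ' :: Δ) (H, X) = π.interp H :=
  π.interp_rename _ H (show KEnv.Interp (κ' :: Δ) from (H, X)) fun _ _ => rfl

/-- `H` is the environment obtained from `H'` by the substitution `s`. -/
def Sub.Respects {Δ Δ' : KEnv} (s : Sub Lbl Δ Δ') (H : KEnv.Interp.{u} Δ)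
    (H' : KEnv.Interp.{u} Δ') : Prop :=
  ∀ (κ : Kind) (x : TVar Δ κ), (s κ x).interp H' = x.lookup H

theorem Sub.Respects.lift {Δ Δ' : KEnv} {s : Sub Lbl Δ Δ'} {H : KEnv.Interp.{u} Δ}
    {H' : KEnv.Interp.{u} Δ'} (hs : s.Respects H H') {κ' : Kind} (X : κ'.Interp) :
    (s.lift κ').Respects (Δ := κ' :: Δ) (Δ' := κ' :: Δ') (H, X) (H', X)
  | _, .zero => rfl
  | _, .succ x => ((s _ x).interp_wk H' X).trans (hs _ x)

mutual

theorem Ty.interp_subst {Δ Δ' : KEnv} {κ : Kind} (s : Sub Lbl Δ Δ') (H : KEnv.Interp.{u} Δ)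
    (H' : KEnv.Interp.{u} Δ') (hs : s.Respects H H') :
    ∀ τ : Ty Lbl Δ κ, (τ.subst s).interp H' = τ.interp H
  | .var x => hs _ x
  | .up h τ => congrArg (Univ.up h) (τ.interp_subst s H H' hs)
  | .arr _ => rfl
  | .imp _ π τ => congrArg₂ (fun p a => Code.imp (RowPred.Evidence p) a)
      (π.interp_subst s H H' hs) (τ.interp_subst s H H' hs)
  | .all κ h τ => congrArg (Univ.all κ h)
      (funext fun X => τ.interp_subst (s.lift κ) (H, X) (H', X) (hs.lift X))
  | .lam κ τ => funext fun X => τ.interp_subst (s.lift κ) (H, X) (H', X) (hs.lift X)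
  | .app φ τ => congr (φ.interp_subst s H H' hs) (τ.interp_subst s H H' hs)
  | .lab _ => rfl
  | .sing _ => rfl
  | .lty _ τ => τ.interp_subst s H H' hs
  | .row _ τ => congrArg Row.single (τ.interp_subst s H H' hs)
  | .pi ρ => congrArg (piOp _) (ρ.interp_subst s H H' hs)
  | .sigma ρ => congrArg (sigmaOp _) (ρ.interp_subst s H H' hs)
  | .lift₁ (κ₁ := κ₁) (κ₂ := κ₂) ρ τ => congrArg₂
      (fun R X => Row.map (fun f : (Kind.arr κ₁ κ₂).Interp => f X) R)
      (ρ.interp_subst s H H' hs) (τ.interp_subst s H H' hs)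
  | .lift₂ φ ρ => congrArg₂ Row.map (φ.interp_subst s H H' hs) (ρ.interp_subst s H H' hs)

theorem Pred.interp_subst {Δ Δ' : KEnv} {κ : Kind} (s : Sub Lbl Δ Δ') (H : KEnv.Interp.{u} Δ)
    (H' : KEnv.Interp.{u} Δ') (hs : s.Respects H H') :
    ∀ π : Pred Lbl Δ κ, (π.subst s).interp H' = π.interp H
  | .leq _ ρ₁ ρ₂ => congrArg₂ RowPred.leq (ρ₁.interp_subst s H H' hs) (ρ₂.interp_subst s H H' hs)
  | .plus ρ₁ ρ₂ ρ₃ => congr (congrArg₂ RowPred.plus (ρ₁.interp_subst s H H' hs)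
      (ρ₂.interp_subst s H H' hs)) (ρ₃.interp_subst s H H' hs)

end

theorem Ty.interp_inst {Δ : KEnv} {κ κ' : Kind} (τ : Ty Lbl (κ' :: Δ) κ) (υ : Ty Lbl Δ κ')
    (H : KEnv.Interp.{u} Δ) : (τ.inst υ).interp H = τ.interp (Δ := κ' :: Δ) (H, υ.interp H) :=
  τ.interp_subst (Sub.single υ) (show KEnv.Interp (κ' :: Δ) from (H, υ.interp H)) H fun
    | _, .zero => rfl
    | _, .succ _ => rfl

/-! # Soundness of type and predicate equivalence -/

mutual

theorem TyEq.interp_eq {Δ : KEnv} {κ : Kind} {τ₁ τ₂ : Ty Lbl Δ κ} :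
    TyEq τ₁ τ₂ → ∀ H : KEnv.Interp.{u} Δ, τ₁.interp H = τ₂.interp H
  | .refl _, _ => rfl
  | .symm h, H => (h.interp_eq H).symm
  | .trans h h', H => (h.interp_eq H).trans (h'.interp_eq H)
  | .beta τ υ, H => (τ.interp_inst υ H).symm
  | .imp _ h h', H => congrArg₂ (fun p a => Code.imp (RowPred.Evidence p) a)
      (h.interp_eq H) (h'.interp_eq H)
  | .all (κ := κ) hk h, H => congrArg (Univ.all κ hk) (funext fun X => h.interp_eq (H, X))
  | .lam h, H => funext fun X => h.interp_eq (H, X)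
  | .app h h', H => congrArg₂ (fun f X => f X) (h.interp_eq H) (h'.interp_eq H)
  | .lift₁ (κ₁ := κ₁) (κ₂ := κ₂) h h', H => congrArg₂
      (fun R X => Row.map (fun f : (Kind.arr κ₁ κ₂).Interp => f X) R)
      (h.interp_eq H) (h'.interp_eq H)
  | .lift₂ h h', H => congrArg₂ Row.map (h.interp_eq H) (h'.interp_eq H)
  | .lty _ h, H => h.interp_eq H
  | .row _ h, H => congrArg Row.single (h.interp_eq H)
  | .sing _, _ => rfl
  | .pi h, H => congrArg (piOp _) (h.interp_eq H)
  | .sigma h, H => congrArg (sigmaOp _) (h.interp_eq H)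
  | .lift₁_row _ _ _, _ => rfl
  | .lift₂_row _ _ _, _ => rfl
  | .lift₃_pi _ _, _ => rfl
  | .lift₃_sigma _ _, _ => rfl
  | .up h h', H => congrArg (Univ.up h) (h'.interp_eq H)
  | .up_refl h _, _ => Univ.up_refl h _
  | .up_trans h h' _, _ => Univ.up_up h h' _
  | .up_arr _ _ _, _ => rfl
  | .up_imp _ _ _ _, _ => rfl
  | .up_all _ _ _, _ => rfl
  | .up_lty _ _ _, _ => rfl
  | .up_pi _ _, _ => rfl
  | .up_sigma _ _, _ => rfl

theorem PredEq.interp_eq {Δ : KEnv} {κ : Kind} {π₁ π₂ : Pred Lbl Δ κ} :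
    PredEq π₁ π₂ → ∀ H : KEnv.Interp.{u} Δ, π₁.interp H = π₂.interp H
  | .leq _ h h', H => congrArg₂ RowPred.leq (h.interp_eq H) (h'.interp_eq H)
  | .plus h h' h'', H => by
      simp only [Pred.interp, h.interp_eq H, h'.interp_eq H, h''.interp_eq H]

end

/-! # Weakening of environments and the type of label-generic bodies -/

theorem PEnv.interp_wk {Δ : KEnv} {κ : Kind} (H : KEnv.Interp.{u} Δ) (X : κ.Interp) :
    ∀ Φ : PEnv Lbl Δ, Φ.wk.Interp (Δ := κ :: Δ) (H, X) = Φ.Interp H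
  | .nil => rfl
  | .cons Φ π => congrArg₂ Prod (Φ.interp_wk H X) (congrArg RowPred.Evidence (π.interp_wk H X))

theorem Env.interp_wk {Δ : KEnv} {κ : Kind} (H : KEnv.Interp.{u} Δ) (X : κ.Interp) :
    ∀ Γ : Env Lbl Δ, Γ.wk.Interp (Δ := κ :: Δ) (H, X) = Γ.Interp H
  | .nil => rfl
  | .cons Γ τ => congrArg₂ Prod (Γ.interp_wk H X) (congrArg Univ.El (τ.interp_wk H X))

/-- The extension of `H` to the generic environment. -/
abbrev KEnv.Interp.generic {Δ : KEnv} {κ : Kind} (H : KEnv.Interp.{u} Δ) (l : Kind.lab.Interp.{u})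
    (a : κ.Interp) (y₁ z y₂ : κ.row.Interp) : KEnv.Interp.{u} (Δ.generic κ) :=
  (((((H, l), a), y₁), z), y₂)

theorem Ty.interp_wkGeneric {Δ : KEnv} {κ κ' : Kind} (τ : Ty Lbl Δ κ') (H : KEnv.Interp.{u} Δ)
    (l : Kind.lab.Interp.{u}) (a : κ.Interp) (y₁ z y₂ : κ.row.Interp) :
    τ.wkGeneric.interp (H.generic l a y₁ z y₂) = τ.interp H := by
  unfold Ty.wkGeneric
  refine (Ty.interp_wk _ _ _).trans <| (Ty.interp_wk _ _ _).trans <| (Ty.interp_wk _ _ _).trans <|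
    (Ty.interp_wk _ _ _).trans <| Ty.interp_wk _ _ _

theorem Ty.el_generic {Δ : KEnv} {κ : Kind} {m : ℕ} (h : κ.level < m) (ρ : Ty Lbl Δ (.row κ))
    (τ : Ty Lbl (Δ.generic κ) (.star m)) (H : KEnv.Interp.{u} Δ) (G : κ.Interp → Type (u + 1))
    (hG : ∀ l a y₁ z y₂, τ.El (H.generic l a y₁ z y₂) = G a) :
    (Ty.generic h ρ τ).El H = Generic (A := κ.Interp) (ρ.interp H) G := by
  refine (Univ.el_all _ _ _).trans (pi_congr fun l => ?_)
  refine (Univ.el_all _ _ _).trans (pi_congr fun a => ?_)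
  refine (Univ.el_all _ _ _).trans (pi_congr fun y₁ => ?_)
  refine (Univ.el_all _ _ _).trans (pi_congr fun z => ?_)
  refine (Univ.el_all _ _ _).trans (pi_congr fun y₂ => ?_)
  change (Plus y₁ (Row.single a) z → Plus z y₂ (ρ.wkGeneric.interp (H.generic l a y₁ z y₂)) →
    PUnit → τ.El (H.generic l a y₁ z y₂)) = _
  rw [ρ.interp_wkGeneric, hG]

theorem Ty.el_up_wkGeneric {Δ : KEnv} {κ : Kind} {k m : ℕ} (hk : k ≤ m) (τ : Ty Lbl Δ (.star k))
    (H : KEnv.Interp.{u} Δ) (l : Kind.lab.Interp.{u}) (a : κ.Interp) (y₁ z y₂ : κ.row.Interp) :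
    (Ty.up hk τ.wkGeneric).El (H.generic l a y₁ z y₂) = τ.El H :=
  (Univ.el_up hk _).trans (congrArg Univ.El (τ.interp_wkGeneric H l a y₁ z y₂))

theorem Ty.el_up_app_wkGeneric {Δ : KEnv} {κ : Kind} {i m : ℕ} (hi : i ≤ m)
    (φ : Ty Lbl Δ (.arr κ (.star i))) (H : KEnv.Interp.{u} Δ) (l : Kind.lab.Interp.{u})
    (a : κ.Interp) (y₁ z y₂ : κ.row.Interp) :
    (Ty.up hi (.app φ.wkGeneric .genericU)).El (H.generic l a y₁ z y₂) =
      Univ.El (φ.interp H a) :=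
  (Univ.el_up hi _).trans
    (congrArg Univ.El (congrFun (φ.interp_wkGeneric H l a y₁ z y₂) a))

theorem Ty.el_generic_ana {Δ : KEnv} {κ : Kind} {i k m : ℕ} (h : κ.level < m)
    (hi : i ≤ k) (hk : k ≤ m) (ρ : Ty Lbl Δ (.row κ)) (φ : Ty Lbl Δ (.arr κ (.star i)))
    (τ : Ty Lbl Δ (.star k)) (H : KEnv.Interp.{u} Δ) :
    (Ty.generic h ρ ((Ty.up (hi.trans hk) (.app φ.wkGeneric .genericU)).fn
      (.up hk τ.wkGeneric))).El H =
      Generic (A := κ.Interp) (ρ.interp H) fun a => Univ.El (φ.interp H a) → τ.El H :=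
  Ty.el_generic h ρ _ H _ fun l a y₁ z y₂ => implies_congr
    (φ.el_up_app_wkGeneric (hi.trans hk) H l a y₁ z y₂) (τ.el_up_wkGeneric hk H l a y₁ z y₂)

theorem Ty.el_generic_fold {Δ : KEnv} {i k m : ℕ} (h : (Kind.star i).level < m)
    (hi : i ≤ m) (hk : k ≤ m) (ρ : Ty Lbl Δ (.row (.star i))) (τ : Ty Lbl Δ (.star k))
    (H : KEnv.Interp.{u} Δ) :
    (Ty.generic h ρ ((Ty.up hi .genericU).fn (.up hk τ.wkGeneric))).El H =
      Generic (A := Univ.{u} i) (ρ.interp H) fun a => Univ.El a → τ.El H :=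
  Ty.el_generic h ρ _ H _ fun l a y₁ z y₂ => implies_congr (Univ.el_up hi a)
    (τ.el_up_wkGeneric hk H l a y₁ z y₂)

/-! # Denotations of entailment derivations and of terms -/

/-- The denotation of entailment derivations. -/
def Ent.den {Δ : KEnv} {Φ : PEnv Lbl Δ} {κ : Kind} {π : Pred Lbl Δ κ} :
    Ent Φ π → (H : KEnv.Interp.{u} Δ) → Φ.Interp H → π.Interp H
  | .ax x, _, e => x.lookup e
  | .refl _ ρ, H, _ => Leq.refl (ρ.interp H)
  | .trans p q, H, e => Leq.trans (p.den H e) (q.den H e)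
  | .conv p h, H, e => cast (congrArg RowPred.Evidence (h.interp_eq H)) (p.den H e)
  | .leqLift₁ φ p, H, e => Leq.map (φ.interp H) (p.den H e)
  | .leqLift₂ (κ₁ := κ₁) (κ₂ := κ₂) τ p, H, e =>
      Leq.map (fun f : (Kind.arr κ₁ κ₂).Interp => f (τ.interp H)) (p.den H e)
  | .plusLift₁ (κ₁ := κ₁) (κ₂ := κ₂) τ p, H, e =>
      Plus.map (fun f : (Kind.arr κ₁ κ₂).Interp => f (τ.interp H)) (p.den H e)
  | .plusLift₂ φ p, H, e => Plus.map (φ.interp H) (p.den H e)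
  | .plusLeft p, H, e => Plus.left (p.den H e)
  | .plusRight p, H, e => Plus.right (p.den H e)

/-- The denotation of terms. -/
def Tm.den {Δ : KEnv} {Φ : PEnv Lbl Δ} {Γ : Env Lbl Δ} {i : ℕ} {τ : Ty Lbl Δ (.star i)} :
    Tm Φ Γ τ → (H : KEnv.Interp.{u} Δ) → Φ.Interp H → Γ.Interp H → τ.El H
  | .var x, _, _, g => x.lookup g
  | .lam (τ := τ) M, H, e, g => fun x : τ.El H => M.den H e (g, x)
  | .app (τ := τ) (υ := υ) M N, H, e, g => (M.den H e g : τ.El H → υ.El H) (N.den H e g)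
  | .conv M h, H, e, g => cast (congrArg Univ.El (h.interp_eq H)) (M.den H e g)
  | .up h M, H, e, g => cast (Univ.el_up h _).symm (M.den H e g)
  | .down (h := h) M, H, e, g => cast (Univ.el_up h _) (M.den H e g)
  | .plam (π := π) _ M, H, e, g => fun p : π.Interp H => M.den H (e, p) g
  | .papp (π := π) (τ := τ) M p, H, e, g =>
      (M.den H e g : π.Interp H → τ.El H) (p.den H e)
  | .tlam (Φ := Φ) (Γ := Γ) (κ := κ) h (τ := τ) M, H, e, g =>
      cast (Univ.el_all κ h fun X => τ.interp (H, X)).symm fun X =>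
        M.den (H, X) (cast (Φ.interp_wk H X).symm e) (cast (Γ.interp_wk H X).symm g)
  | .tapp (κ := κ) (h := h) (τ := τ) M υ, H, e, g =>
      cast (congrArg Univ.El (τ.interp_inst υ H).symm)
        (cast (Univ.el_all κ h fun X => τ.interp (H, X)) (M.den H e g) (υ.interp H))
  | .lab _, _, _, _ => PUnit.unit
  | .label _ N, H, e, g => N.den H e g
  | .unlabel M _, H, e, g => M.den H e g
  | .prj M p, H, e, g => Rec.prj (F := Univ.El) (p.den H e) (M.den H e g)
  | .cat M N p, H, e, g => Rec.cat (F := Univ.El) (p.den H e) (M.den H e g) (N.den H e g)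
  | .inj M p, H, e, g => Var.inj (F := Univ.El) (p.den H e) (M.den H e g)
  | .branch (h := h) (τ := τ) M N p, H, e, g =>
      Var.branch (F := fun a => Univ.El (Univ.up h a)) (T := τ.El H) (p.den H e) (M.den H e g)
        (N.den H e g)
  | .piSingle (τ := τ) M, H, e, g => fun _ : Fin 1 => (M.den H e g : τ.El H)
  | .piUnsingle (τ := τ) M, H, e, g => (M.den H e g : Fin 1 → τ.El H) (0 : Fin 1)
  | .sigmaSingle (τ := τ) M, H, e, g => (⟨(0 : Fin 1), M.den H e g⟩ : (_ : Fin 1) × τ.El H)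
  | .sigmaUnsingle (τ := τ) M, H, e, g => (M.den H e g : (_ : Fin 1) × τ.El H).2
  | .ana h hi hk ρ φ (τ := τ) M, H, e, g =>
      cast (implies_congr (Univ.el_up hi _).symm rfl)
        (Generic.ana (F := fun a => Univ.El (φ.interp H a)) (T := τ.El H)
          (cast (Ty.el_generic_ana h hi hk ρ φ τ H) (M.den H e g)))
  | .syn h hi ρ φ M, H, e, g =>
      Generic.syn (F := fun a => Univ.El (φ.interp H a)) (cast (Ty.el_generic h ρ _ H _ (φ.el_up_app_wkGeneric hi H)) (M.den H e g))
  | .fold h hi hk (ρ := ρ) (τ := τ) M₁ M₂ M₃ N, H, e, g =>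
      Generic.fold (F := Univ.El) (T := τ.El H)
        (cast (Ty.el_generic_fold h hi hk ρ τ H) (M₁.den H e g))
        (M₂.den H e g) (M₃.den H e g) (N.den H e g)

theorem isEntDen_den : IsEntDen.{u} (Lbl := Lbl) Ent.den where
  ax _ _ _ := rfl
  refl _ _ _ _ := rfl
  trans _ _ _ _ := rfl
  conv _ _ _ _ := cast_heq _ _
  leqLift₁ _ _ _ _ := rfl
  leqLift₂ _ _ _ _ := rfl
  plusLift₁ _ _ _ _ := rfl
  plusLift₂ _ _ _ _ := rfl
  plusLeft _ _ _ := rfl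
  plusRight _ _ _ := rfl

theorem isTmDen_den : IsTmDen.{u} (Lbl := Lbl) Ent.den Tm.den where
  var _ _ _ _ := rfl
  lam _ _ _ _ := rfl
  app _ _ _ _ _ := rfl
  conv _ _ _ _ _ := cast_heq _ _
  up _ _ _ _ _ _ := cast_heq _ _
  down _ _ _ _ := cast_heq _ _
  plam _ _ _ _ _ _ _ := rfl
  papp _ _ _ _ _ := rfl
  tlam {_ Φ Γ κ _} h τ M H e g :=
    ⟨fun X => M.den (H, X) (cast (Φ.interp_wk H X).symm e) (cast (Γ.interp_wk H X).symm g),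
      (cast_heq (Univ.el_all κ h fun X => τ.interp (H, X)).symm _).symm,
      fun _ => ⟨_, _, cast_heq _ _, cast_heq _ _, rfl⟩⟩
  tapp {_ _ _ κ _ h τ} M _ H e g :=
    ⟨cast (Univ.el_all κ h fun X => τ.interp (H, X)) (M.den H e g), cast_heq _ _, cast_heq _ _⟩
  lab _ _ _ _ := rfl
  label _ _ _ _ _ := rfl
  unlabel _ _ _ _ _ := rfl
  prj _ _ _ _ _ := rfl
  cat _ _ _ _ _ _ := rfl
  inj _ _ _ _ _ := rfl
  branch _ _ _ _ _ _ := rfl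
  piSingle _ _ _ _ := rfl
  piUnsingle _ _ _ _ := rfl
  sigmaSingle _ _ _ _ := rfl
  sigmaUnsingle _ _ _ _ := rfl
  ana h hi hk ρ φ τ M H e g :=
    ⟨cast (Ty.el_generic_ana h hi hk ρ φ τ H) (M.den H e g), cast_heq _ _, cast_heq _ _⟩
  syn h hi ρ φ M H e g :=
    ⟨cast (Ty.el_generic h ρ _ H _ (φ.el_up_app_wkGeneric hi H)) (M.den H e g),
      cast_heq _ _, rfl⟩
  fold h hi hk ρ τ M₁ _ _ _ H e g :=
    ⟨cast (Ty.el_generic_fold h hi hk ρ τ H) (M₁.den H e g), cast_heq _ _, rfl⟩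

end Substitution

end ROmega

theorem mainTheorem1 (Lbl : Type) :
    ∃ (E : ROmega.EntDen.{u} Lbl) (D : ROmega.TmDen.{u} Lbl),
      ROmega.IsEntDen E ∧ ROmega.IsTmDen E D :=
  ⟨ROmega.Ent.den, ROmega.Tm.den, ROmega.isEntDen_den, ROmega.isTmDen_den⟩
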